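/- **Theorem 3.10.** Let $X$ be a triangle complex, i.e. a simplicial complex in which every cell lies in a triangle, and suppose that the degrees of its edges are globally bounded (the degree $\deg\sigma$ of an edge $\sigma$ is the number of triangles containing it). A $1$-form is a real function $f$ of the oriented edges with $f([w,v])=-f([v,w])$; let $\Omega^1_{L^2}(X)$ be the Hilbert space of $1$-forms with $\sum_{\sigma}f(\sigma)^2/\deg\sigma<\infty$ and inner product $\langle f,g\rangle=\sum_{\sigma}f(\sigma)g(\sigma)/\deg\sigma$ (sums over unoriented edges). The upper Laplacian is $$(\Delta^+f)([v,w])=\sum_{u:\,\{u,v,w\}\in X}\left(\frac{f([v,w])}{\deg\{v,w\}}-\frac{f([u,w])}{\deg\{u,w\}}+\frac{f([u,v])}{\deg\{u,v\}}\right).$$ Let $B^1(X)\subseteq\Omega^1_{L^2}(X)$ be the space of those square-summable $1$-forms that are of the form $[v,w]\mapsto\deg\{v,w\}\,(g(w)-g(v))$ for a square-summable function $g$ on the vertices, let $Z_1(X)=B^1(X)^{\perp}$, and define the spectral gap $\lambda(X)=\min\operatorname{Spec}\big(\Delta^+|_{Z_1(X)}\big)$. Let $T_2^2$ be the $2$-regular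 arboreal triangle complex: start with a triangle, attach to each of its edges one new triangle with one new vertex, and continue inductively, attaching at every step one new triangle with one new vertex to each boundary edge. It is $2$-regular (every edge lies in exactly two triangles) and arboreal: any two edges are joined by a chain of edges in which the union of consecutive edges is a triangle, and there is no non-backtracking closed chain $\sigma_0,\dots,\sigma_n=\sigma_0$ ($n\ge1$) of triangles in which consecutive ones share an edge (non-backtracking: $\sigma_i\ne\sigma_{i+2}$ for $0\le i\le n-2$). For an edge $e_0$ of $T_2^2$ let $X_r=B_r(T_2^2,e_0)$ be the ball of radius $r$ around $e_0$, i.e. the subcomplex formed by the edges and triangles all of whose edges are at distance at most $r$ from $e_0$, where the distance of two edges is the least length of a chain of edges between them in which the union of consecutive edges is a triangle. Then $$\lim_{r\to\infty}\lambda(X_r)=\tfrac32-\sqrt2,\qquad\text{while}\qquad\lambda(T_2^2)=0$$ (the minima defining $\lambda(T_2^2)$ and $\lambda(X_r)$, $r\ge1$, exist). So the high-dimensional analogue of the Alon–Boppana theorem fails in general: the balls $X_r$ converge to $T_2^2$ as $r\to\infty$, but $\liminf_{r\to\infty}\lambda(X_r)>\lambda(T_2^2)$. Here a sequence of complexes $Y_n$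 with globally bounded edge degrees converges to $Y$ if, for some choice of edges $e_n$ of $Y_n$ and $e$ of $Y$, the distance of $(Y_n,e_n)$ and $(Y,e)$ tends to $0$, where the distance of two marked complexes $(Y,e)$, $(Y',e')$ is the infimum of $\frac1{m+1}$ over all $m$ for which there is an isomorphism $B_m(Y,e)\cong B_m(Y',e')$ taking $e$ to $e'$. -/

import Mathlib

open Filter Topology

noncomputable section

namespace PreAbstractSimplicialComplex

section General

variable {V : Type*} (X : PreAbstractSimplicialComplex V)

/-- The `j`-dimensional cells: faces with `j + 1` vertices. -/
def cells (j : ℕ) : Set (Finset V) := {s | s ∈ X.faces ∧ s.card = j + 1}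

/-- The triangles that contain a given cell. -/
def cofaces (e : Finset V) : Set (Finset V) := {t | t ∈ X.cells 2 ∧ e ⊆ t}

/-- A triangle complex: a nonempty uniform complex of dimension two, i.e. every face lies in a
triangle. -/
def IsTriangleComplex : Prop :=
  (X.cells 2).Nonempty ∧ ∀ s ∈ X.faces, ∃ t ∈ X.cells 2, s ⊆ t

/-- Every edge is contained in exactly `k` triangles. -/
def IsRegular (k : ℕ) : Prop := ∀ e ∈ X.cells 1, (X.cofaces e).encard = k

/-- The degree of an edge: the number of triangles that contain it. -/
def deg (e : Finset V) : ℕ := (X.cofaces e).ncard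

/-- The weight `1 / deg e` of an edge. In a uniform complex the degree of an edge is at least one;
an edge lying in no triangle at all (a ball of radius zero) is given weight one. -/
def weight (e : Finset V) : ℝ := (max 1 (X.deg e : ℝ))⁻¹

theorem weight_pos (e : Finset V) : 0 < X.weight e :=
  inv_pos.mpr (lt_of_lt_of_le one_pos (le_max_left _ _))

variable [DecidableEq V]

/-- Two edges are adjacent when their union is a triangle of the complex. -/
def edgeGraph : SimpleGraph (Finset V) where
  Adj e e' := e ∈ X.cells 1 ∧ e' ∈ X.cells 1 ∧ e ∪ e' ∈ X.cells 2
  symm := ⟨fun e e' h => ⟨h.2.1, h.1, by rw [Finset.union_comm]; exact h.2.2⟩⟩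
  loopless := ⟨fun e h => by
    have h1 := h.1.2
    have h2 := h.2.2.2
    rw [Finset.union_self] at h2
    omega⟩

/-- `1`-connectedness: any two edges are joined by a chain of edges, consecutive ones spanning a
triangle. -/
def IsOneConnected : Prop :=
  ∀ e ∈ X.cells 1, ∀ e' ∈ X.cells 1, X.edgeGraph.Reachable e e'

/-- There is a non-backtracking closed chain `σ 0, …, σ n = σ 0` of triangles (of positive length),
consecutive ones meeting in an edge. -/
def HasSimpleLoop : Prop :=
  ∃ (n : ℕ) (σ : ℕ → Finset V), 1 ≤ n ∧ (∀ i ≤ n, σ i ∈ X.cells 2) ∧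
    (∀ i < n, (σ i ∩ σ (i + 1)).card = 2) ∧ (∀ i, i + 2 ≤ n → σ i ≠ σ (i + 2)) ∧ σ n = σ 0

/-- Arboreal triangle complexes. -/
def IsArboreal : Prop := X.IsTriangleComplex ∧ X.IsOneConnected ∧ ¬ X.HasSimpleLoop

/-- The ball of radius `r` around the edge `e₀`: the subcomplex formed by the edges and triangles
of `X` (with all their faces) all of whose edges are at distance at most `r` from `e₀`, where
the distance of two edges is the length of a shortest chain between them. -/
def ball (e₀ : Finset V) (r : ℕ) : PreAbstractSimplicialComplex V where
  faces := {s | s.Nonempty ∧ ∃ t ∈ X.faces, s ⊆ t ∧ 2 ≤ t.card ∧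
    ∀ e ∈ X.cells 1, e ⊆ t → X.edgeGraph.edist e₀ e ≤ r}
  isRelLowerSet_faces := fun s hs => ⟨hs.1, fun u hus hu => by
    obtain ⟨t, ht, hst, h⟩ := hs.2
    exact ⟨hu, t, ht, le_trans hus hst, h⟩⟩

/-! ### Forms

A `1`-form is an antisymmetric function of the oriented edge `[v, w]`, extended by zero to the
pairs that do not span an edge; a `0`-form is a function of the vertices. -/

/-- The summand of the squared norm of a `1`-form. -/
def sqTerm (f : V → V → ℝ) (p : V × V) : ℝ := X.weight {p.1, p.2} * f p.1 p.2 ^ 2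

theorem summable_cross {ι : Type*} {w a b : ι → ℝ} (hw : ∀ i, 0 < w i)
    (ha : Summable fun i => w i * a i ^ 2) (hb : Summable fun i => w i * b i ^ 2) :
    Summable fun i => w i * (a i * b i) := by
  refine Summable.of_norm_bounded (ha.add hb) fun i => ?_
  have h := (hw i).le
  rw [Real.norm_eq_abs, abs_mul, abs_of_pos (hw i), ← mul_add]
  refine mul_le_mul_of_nonneg_left ?_ h
  rw [abs_le]
  constructor <;> nlinarith [sq_nonneg (a i + b i), sq_nonneg (a i - b i), sq_nonneg (a i),
    sq_nonneg (b i)]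

theorem summable_add_sq {ι : Type*} {w a b : ι → ℝ} (hw : ∀ i, 0 < w i)
    (ha : Summable fun i => w i * a i ^ 2) (hb : Summable fun i => w i * b i ^ 2) :
    Summable fun i => w i * (a i + b i) ^ 2 :=
  ((ha.add hb).add ((summable_cross hw ha hb).mul_left 2)).congr fun i => by ring

/-- The `1`-forms with finite norm, as a space of functions on ordered pairs. -/
def l2Forms : Submodule ℝ (V → V → ℝ) where
  carrier := {f | (∀ v w, f w v = - f v w) ∧ (∀ v w, {v, w} ∉ X.cells 1 → f v w = 0) ∧
    Summable (X.sqTerm f)}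
  zero_mem' := by
    refine ⟨by simp, by simp, ?_⟩
    exact (summable_zero : Summable fun _ : V × V => (0 : ℝ)).congr fun p => by simp [sqTerm]
  add_mem' := by
    rintro f g ⟨hf1, hf2, hf3⟩ ⟨hg1, hg2, hg3⟩
    refine ⟨fun v w => ?_, fun v w h => ?_, ?_⟩
    · simp only [Pi.add_apply, hf1 v w, hg1 v w]; ring
    · simp [hf2 v w h, hg2 v w h]
    · exact summable_add_sq (w := fun p : V × V => X.weight {p.1, p.2})
        (a := fun p => f p.1 p.2) (b := fun p => g p.1 p.2) (fun p => X.weight_pos _) hf3 hg3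
  smul_mem' := by
    rintro c f ⟨hf1, hf2, hf3⟩
    refine ⟨fun v w => ?_, fun v w h => ?_, ?_⟩
    · simp [hf1 v w]
    · simp [hf2 v w h]
    · exact (hf3.mul_left (c ^ 2)).congr fun p => by
        simp only [sqTerm, Pi.smul_apply, smul_eq_mul]; ring

/-- The space of square-summable `1`-forms. (It does not carry the topology of pointwise
convergence, but that of the weighted inner product below.) -/
def L2Form : Type _ := ↥X.l2Forms

instance : AddCommGroup X.L2Form := inferInstanceAs (AddCommGroup ↥X.l2Forms)

instance : Module ℝ X.L2Form := inferInstanceAs (Module ℝ ↥X.l2Forms)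

instance : CoeFun X.L2Form (fun _ => V → V → ℝ) := ⟨fun f => f.1⟩

/-- The inner product `⟨f, g⟩ = ∑_σ f(σ) g(σ) / deg σ` over the unoriented edges `σ`; each edge
appears twice in the sum over ordered pairs, whence the factor one half. -/
@[reducible]
def innerCore : InnerProductSpace.Core ℝ X.L2Form where
  inner f g := (1 / 2) * ∑' p : V × V, X.weight {p.1, p.2} * (f p.1 p.2 * g p.1 p.2)
  conj_inner_symm f g := by
    simp only [conj_trivial, mul_comm (g _ _)]
  re_inner_nonneg f := by
    simp only [RCLike.re_to_real]
    refine mul_nonneg (by norm_num) (tsum_nonneg fun p => ?_)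
    exact mul_nonneg (X.weight_pos _).le (mul_self_nonneg _)
  add_left f g h := by
    have hf : Summable fun p : V × V => X.weight {p.1, p.2} * (f p.1 p.2 * h p.1 p.2) :=
      summable_cross (fun p : V × V => X.weight_pos {p.1, p.2}) f.2.2.2 h.2.2.2
    have hg : Summable fun p : V × V => X.weight {p.1, p.2} * (g p.1 p.2 * h p.1 p.2) :=
      summable_cross (fun p : V × V => X.weight_pos {p.1, p.2}) g.2.2.2 h.2.2.2
    rw [← mul_add, ← hf.tsum_add hg]
    congr 1
    refine tsum_congr fun p => ?_
    change _ * ((f p.1 p.2 + g p.1 p.2) * _) = _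
    ring
  smul_left f g c := by
    simp only [conj_trivial]
    rw [mul_left_comm, ← tsum_mul_left (f := fun p : V × V => X.weight {p.1, p.2} * (f p.1 p.2 * g p.1 p.2))]
    congr 1
    refine tsum_congr fun p => ?_
    change _ * ((c * f p.1 p.2) * _) = _
    ring
  definite f hf := by
    have hs : Summable fun p : V × V => X.weight {p.1, p.2} * (f p.1 p.2 * f p.1 p.2) :=
      summable_cross (fun p : V × V => X.weight_pos {p.1, p.2}) f.2.2.2 f.2.2.2
    have h0 : ∑' p : V × V, X.weight {p.1, p.2} * (f p.1 p.2 * f p.1 p.2) = 0 := by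
      have : (1 / 2 : ℝ) * _ = 0 := hf
      simpa using this
    have h1 := (hs.hasSum_iff.mpr h0)
    rw [hasSum_zero_iff_of_nonneg
      (fun p => mul_nonneg (X.weight_pos _).le (mul_self_nonneg _))] at h1
    refine Subtype.ext (funext fun v => funext fun w => ?_)
    have h2 := congrFun h1 (v, w)
    have h3 := (X.weight_pos {v, w}).ne'
    change f v w = 0
    simpa [h3] using h2

instance : NormedAddCommGroup X.L2Form := X.innerCore.toNormedAddCommGroup

instance : InnerProductSpace ℝ X.L2Form := InnerProductSpace.ofCore X.innerCore.toCore

/-! ### Boundary and coboundary operators, the upper Laplacian -/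

open Classical in
/-- The coboundary of a `0`-form: `(δ₁ g)[v, w] = deg{v, w} (g(w) - g(v))`. -/
def coboundaryZero (g : V → ℝ) (v w : V) : ℝ :=
  if {v, w} ∈ X.cells 1 then (X.weight {v, w})⁻¹ * (g w - g v) else 0

open Classical in
/-- The coboundary of a `1`-form:
`(δ₂ f)[u, v, w] = f[v, w] / deg{v, w} - f[u, w] / deg{u, w} + f[u, v] / deg{u, v}`. -/
def coboundaryOne (f : V → V → ℝ) (u v w : V) : ℝ :=
  if {u, v, w} ∈ X.cells 2 then
    X.weight {v, w} * f v w - X.weight {u, w} * f u w + X.weight {u, v} * f u v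
  else 0

/-- The boundary of a `2`-form: `(∂₂ F)[v, w]` is the sum of `F[u, v, w]` over all vertices `u`
that span a triangle with `v, w`. -/
def boundaryTwo (F : V → V → V → ℝ) (v w : V) : ℝ :=
  ∑ᶠ u ∈ {u : V | {u, v, w} ∈ X.cells 2}, F u v w

/-- The upper Laplacian `Δ⁺ = ∂₂ δ₂` on `1`-forms. -/
def upperLaplacian (f : V → V → ℝ) : V → V → ℝ := X.boundaryTwo (X.coboundaryOne f)

/-- The space `B¹` of coboundaries: the square-summable `1`-forms `δ₁ g` with `g` a
square-summable `0`-form. -/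
def coboundaries : Submodule ℝ X.L2Form where
  carrier := {f | ∃ g : V → ℝ, (∀ v, {v} ∉ X.cells 0 → g v = 0) ∧
    (Summable fun v => g v ^ 2) ∧ ∀ v w, f v w = X.coboundaryZero g v w}
  zero_mem' := by
    refine ⟨0, by simp, by simp, fun v w => ?_⟩
    change (0 : ℝ) = _
    simp [coboundaryZero]
  add_mem' := by
    rintro f f' ⟨g, h1, h2, h3⟩ ⟨g', h1', h2', h3'⟩
    refine ⟨g + g', fun v hv => by simp [h1 v hv, h1' v hv], ?_, fun v w => ?_⟩
    · have := summable_add_sq (w := fun _ : V => (1 : ℝ)) (a := g) (b := g') (fun _ => one_pos)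
        (by simpa using h2) (by simpa using h2')
      simpa using this
    · change f v w + f' v w = _
      rw [h3, h3']
      unfold coboundaryZero
      split_ifs
      · simp only [Pi.add_apply]; ring
      · simp
  smul_mem' := by
    rintro c f ⟨g, h1, h2, h3⟩
    refine ⟨c • g, fun v hv => by simp [h1 v hv], ?_, fun v w => ?_⟩
    · exact (h2.mul_left (c ^ 2)).congr fun v => by
        simp only [Pi.smul_apply, smul_eq_mul]; ring
    · change c * f v w = _
      rw [h3]
      unfold coboundaryZero
      split_ifs
      · simp only [Pi.smul_apply, smul_eq_mul]; ring
      · simp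

/-- The space `Z₁`, the orthogonal complement of `B¹`. -/
def cycles : Submodule ℝ X.L2Form := X.coboundariesᗮ

/-- The spectrum of the bounded self-adjoint operator that `Δ⁺` induces on `Z₁`. The operator `T`
is determined by the formula for `Δ⁺`, and it exists when the degrees of the edges are bounded
(otherwise this set is empty). As it is self-adjoint, its spectrum over `ℝ` is its spectrum. -/
def gapSpectrum : Set ℝ :=
  {μ | ∃ T : X.cycles →L[ℝ] X.cycles,
    (∀ (f : X.cycles) (v w : V), (T f).1 v w = X.upperLaplacian f.1 v w) ∧ μ ∈ spectrum ℝ T}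

/-- The spectral gap `λ(X) = min Spec (Δ⁺|_{Z₁})`. -/
def spectralGap : ℝ := sInf X.gapSpectrum

end General

section Convergence

variable {V W : Type*} [DecidableEq V] [DecidableEq W]

/-- There is an isomorphism of complexes from `X` to `Y` that takes `e` to `e'`. -/
def MarkedIso (X : PreAbstractSimplicialComplex V) (e : Finset V)
    (Y : PreAbstractSimplicialComplex W) (e' : Finset W) : Prop :=
  ∃ φ : V → W, Set.InjOn φ {v | {v} ∈ X.faces} ∧ X.map φ = Y ∧ e.image φ = e'

/-- The distance of two marked complexes: the infimum of `1 / (n + 1)` over all `n` for which the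
balls of radius `n` around the marked edges are isomorphic. -/
def markedDist (X : PreAbstractSimplicialComplex V) (e : Finset V)
    (Y : PreAbstractSimplicialComplex W) (e' : Finset W) : ℝ :=
  sInf {x : ℝ | ∃ n : ℕ, MarkedIso (X.ball e n) e (Y.ball e' n) e' ∧ x = 1 / ((n : ℝ) + 1)}

/-- A sequence of complexes with globally bounded edge degrees converges to `Y` if, for some choice
of marked edges, it converges as a sequence of marked complexes. -/
def ConvergesTo (X : ℕ → PreAbstractSimplicialComplex V)
    (Y : PreAbstractSimplicialComplex W) : Prop :=
  (∃ K : ℕ, ∀ n, ∀ e ∈ (X n).cells 1, ((X n).cofaces e).encard ≤ K) ∧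
  ∃ (e : ℕ → Finset V) (e' : Finset W), (∀ n, e n ∈ (X n).cells 1) ∧ e' ∈ Y.cells 1 ∧
    Tendsto (fun n => markedDist (X n) (e n) Y e') atTop (𝓝 0)

end Convergence

end PreAbstractSimplicialComplex

/-! ### The `2`-regular arboreal triangle complex

Start with a triangle on the vertices `0, 1, 2`. To every boundary edge attach one new triangle,
with one new vertex, and go on with the two new boundary edges of each new triangle. The edges
are thus indexed by `(i, w)`, where `i` is one of the three edges of the first triangle and the
word `w` (last letter first) says which of the two new edges is taken at each step. The vertex
opposite to the edge `(i, w)` in the triangle attached to it is again called `(i, w)`. -/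

/-- The vertices: the three of the first triangle, and one new vertex for each edge. -/
abbrev T22Vertex : Type := Fin 3 ⊕ (Fin 3 × List Bool)

/-- The two end points of the edge `(i, w)`. -/
def T22.ends (i : Fin 3) : List Bool → T22Vertex × T22Vertex
  | [] => (Sum.inl i, Sum.inl (i + 1))
  | false :: w => ((T22.ends i w).1, Sum.inr (i, w))
  | true :: w => (Sum.inr (i, w), (T22.ends i w).2)

/-- The first triangle, and the triangles attached to the edges. -/
def T22.triangles : Set (Finset T22Vertex) :=
  insert {Sum.inl 0, Sum.inl 1, Sum.inl 2}
    {t | ∃ (i : Fin 3) (w : List Bool),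
      t = {(T22.ends i w).1, (T22.ends i w).2, Sum.inr (i, w)}}

/-- The `2`-regular arboreal triangle complex. -/
def T22 : PreAbstractSimplicialComplex T22Vertex where
  faces := {s | s.Nonempty ∧ ∃ t ∈ T22.triangles, s ⊆ t}
  isRelLowerSet_faces := fun s hs => ⟨hs.1, fun u hus hu => by
    obtain ⟨t, ht, hst⟩ := hs.2
    exact ⟨hu, t, ht, le_trans hus hst⟩⟩

end

/-!
The edges of `T22` are labelled by `T22.Edge` and its triangles by `Option T22.Edge`: the edge `e`
is a side of exactly two triangles, `T22.tri (T22.parent e)`, together with which it appeared, and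
`T22.tri (some e)`, which was attached to it. Thus the triangles form a `3`-regular tree, and this
gives the assertions on the combinatorics of `T22`.

Orient the edges as in `T22.ends` and the triangles compatibly. For every subcomplex `X` of `T22`
the upper Laplacian is then `∂ δ`, where `(∂ F) e = F (parent e) - F (some e)` for a function `F`
of the triangles of `X` (extended by zero) and `δ` is the adjoint of `∂`
(`T22.upperLaplacian_eq`, `T22.inner_boundary`). The spectra of `∂ δ` and `δ ∂` agree away from zero,
and `δ ∂` is `3 / 2 - A / 2` plus a nonnegative potential on the boundary, `A` being the adjacency
operator of the tree of triangles.

* For `T22` itself, each vertex has infinitely many neighbours, so that no nonzero square-summable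
  function has a square-summable coboundary (`T22.coboundaries_eq_bot`). All forms are
  cycles, and there is a square-summable closed form, halved from each edge to the two edges that
  come after it (`T22.coboundary_closedForm`). Hence zero is in the spectrum of the
  nonnegative operator `∂ δ`.

* In a ball, closed forms are coboundaries of finitely supported functions
  (`T22.mem_coboundaries_of_coboundary_eq_zero`), so that `∂ δ` is injective on cycles and its least
  eigenvalue there is the minimum of `‖∂ F‖ ^ 2 / ‖F‖ ^ 2` (`exists_isLeast_spectrum_comp`).
  As `A` is at most `2 √2`, this is at least `3 / 2 - √2`
  (`T22.le_norm_sq_boundary`). A function that decays like `2 ^ (-k / 2)` on the triangles below the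
  centre shows that it is at most `3 / 2 - √2 + 3 / r` (`T22.exists_testForm`).
-/

noncomputable section

/-! ### Labels of the edges and triangles of `T22` -/

namespace T22

/-- The labels `(i, w)` of the edges of `T22`. -/
abbrev Edge : Type := Fin 3 × List Bool

/-- The first end point of an edge, for the orientation given by `T22.ends`. -/
def src (e : Edge) : T22Vertex := (ends e.1 e.2).1

/-- The second end point of an edge, for the orientation given by `T22.ends`. -/
def tgt (e : Edge) : T22Vertex := (ends e.1 e.2).2

/-- The edge with a given label, as a cell. -/
def edge (e : Edge) : Finset T22Vertex := {src e, tgt e}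

/-- The triangles of `T22`, labelled by `none` (the first triangle) and by `some e` (the triangle
attached to the edge `e`). -/
def tri : Option Edge → Finset T22Vertex
  | none => {Sum.inl 0, Sum.inl 1, Sum.inl 2}
  | some e => {src e, tgt e, Sum.inr e}

/-- The triangle in whose construction the edge `e` appeared; the only other triangle containing
`e` is `tri (some e)`. -/
def parent : Edge → Option Edge
  | (_, []) => none
  | (i, _ :: w) => some (i, w)

/-- The edge `e` is a side of the triangle `t`. -/
def Incident (e : Edge) (t : Option Edge) : Prop := parent e = t ∨ some e = t

/-- The step of the construction at which a vertex appeared. -/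
def depth : T22Vertex → ℕ := Sum.elim (fun _ => 0) (fun e => e.2.length + 1)

/-- The step of the construction at which a triangle appeared. -/
def level : Option Edge → ℕ
  | none => 0
  | some e => e.2.length + 1

@[simp] theorem src_nil (i : Fin 3) : src (i, []) = Sum.inl i := rfl
@[simp] theorem tgt_nil (i : Fin 3) : tgt (i, []) = Sum.inl (i + 1) := rfl
@[simp] theorem src_false (i : Fin 3) (w : List Bool) : src (i, false :: w) = src (i, w) := rfl
@[simp] theorem tgt_false (i : Fin 3) (w : List Bool) : tgt (i, false :: w) = Sum.inr (i, w) := rfl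
@[simp] theorem src_true (i : Fin 3) (w : List Bool) : src (i, true :: w) = Sum.inr (i, w) := rfl
@[simp] theorem tgt_true (i : Fin 3) (w : List Bool) : tgt (i, true :: w) = tgt (i, w) := rfl
@[simp] theorem parent_nil (i : Fin 3) : parent (i, []) = none := rfl
@[simp] theorem parent_cons (i : Fin 3) (b : Bool) (w : List Bool) :
    parent (i, b :: w) = some (i, w) := rfl

theorem depth_src_le : ∀ e : Edge, depth (src e) ≤ e.2.length
  | (i, []) => le_rfl
  | (i, false :: w) => (depth_src_le (i, w)).trans (Nat.le_succ _)
  | (i, true :: w) => le_rfl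

theorem depth_tgt_le : ∀ e : Edge, depth (tgt e) ≤ e.2.length
  | (i, []) => le_rfl
  | (i, true :: w) => (depth_tgt_le (i, w)).trans (Nat.le_succ _)
  | (i, false :: w) => le_rfl

theorem src_ne_inr {e e' : Edge} (h : e.2.length ≤ e'.2.length) : src e ≠ Sum.inr e' := fun h' => by
  have := depth_src_le e
  rw [h'] at this
  simp only [depth, Sum.elim_inr] at this
  omega

theorem tgt_ne_inr {e e' : Edge} (h : e.2.length ≤ e'.2.length) : tgt e ≠ Sum.inr e' := fun h' => by
  have := depth_tgt_le e
  rw [h'] at this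
  simp only [depth, Sum.elim_inr] at this
  omega

theorem src_ne_tgt : ∀ e : Edge, src e ≠ tgt e
  | (i, []) => by fin_cases i <;> simp
  | (i, false :: w) => src_ne_inr (e := (i, w)) (e' := (i, w)) le_rfl
  | (i, true :: w) => (tgt_ne_inr (e := (i, w)) (e' := (i, w)) le_rfl).symm

theorem ends_injective_aux : ∀ e e' : Edge,
    (src e = src e' ∧ tgt e = tgt e' → e = e') ∧ ¬ (src e = tgt e' ∧ tgt e = src e')
  | (i, []), (i', []) => by
    constructor
    · rintro ⟨h, -⟩
      simpa using h
    · fin_cases i <;> fin_cases i' <;> simp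
  | (i, []), (i', b :: w) => by cases b <;> simp
  | (i, b :: w), (i', []) => by cases b <;> simp
  | (i, b :: w), (i', b' :: w') => by
    cases b <;> cases b' <;> simp only [src_false, src_true, tgt_false, tgt_true] <;>
      refine ⟨fun h => ?_, fun h => ?_⟩ <;> obtain ⟨h1, h2⟩ := h
    · simpa using h2
    · rcases le_total w.length w'.length with hl | hl
      · exact src_ne_inr (e := (i, w)) (e' := (i', w')) hl h1
      · exact src_ne_inr (e := (i', w')) (e' := (i, w)) hl h2.symm
    · rcases le_total w.length w'.length with hl | hl
      · exact (src_ne_inr (e := (i, w)) (e' := (i', w')) hl h1).elim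
      · exact (tgt_ne_inr (e := (i', w')) (e' := (i, w)) hl h2.symm).elim
    · rw [Sum.inr.inj h2] at h1
      exact src_ne_tgt _ h1
    · rcases le_total w.length w'.length with hl | hl
      · exact (tgt_ne_inr (e := (i, w)) (e' := (i', w')) hl h2).elim
      · exact (src_ne_inr (e := (i', w')) (e' := (i, w)) hl h1.symm).elim
    · rw [Sum.inr.inj h1] at h2
      exact src_ne_tgt _ h2.symm
    · simpa using h1
    · rcases le_total w.length w'.length with hl | hl
      · exact tgt_ne_inr (e := (i, w)) (e' := (i', w')) hl h2
      · exact tgt_ne_inr (e := (i', w')) (e' := (i, w)) hl h1.symm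

theorem ends_injective : Function.Injective fun e : Edge => (src e, tgt e) := fun e e' h =>
  (ends_injective_aux e e').1 (by simpa using h)

theorem ends_ne_swap (e e' : Edge) : (src e, tgt e) ≠ (tgt e', src e') := fun h =>
  (ends_injective_aux e e').2 (by simpa using h)

theorem edge_eq_pair_iff {e : Edge} {v w : T22Vertex} :
    edge e = {v, w} ↔ (src e = v ∧ tgt e = w) ∨ (src e = w ∧ tgt e = v) := by
  rw [edge, ← Finset.coe_inj]
  push_cast
  exact Set.pair_eq_pair_iff

theorem edge_injective : Function.Injective edge := fun e e' h => by
  rcases edge_eq_pair_iff.1 h with h | h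
  · exact (ends_injective_aux e e').1 h
  · exact ((ends_injective_aux e e').2 h).elim

theorem card_edge (e : Edge) : (edge e).card = 2 := Finset.card_pair (src_ne_tgt e)

theorem card_tri : ∀ t, (tri t).card = 3
  | none => by simp [tri]
  | some e => Finset.card_eq_three.2 ⟨_, _, _, src_ne_tgt e, src_ne_inr le_rfl, tgt_ne_inr le_rfl, rfl⟩

/-- The two-element subsets of a three-element set. -/
theorem subset_three {α : Type*} [DecidableEq α] {a b c : α} {s : Finset α} (hs : s.card = 2)
    (h : s ⊆ {a, b, c}) : s = {a, b} ∨ s = {a, c} ∨ s = {c, b} := by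
  obtain ⟨x, y, hxy, rfl⟩ := Finset.card_eq_two.1 hs
  simp only [Finset.insert_subset_iff, Finset.mem_insert, Finset.singleton_subset_iff,
    Finset.mem_singleton] at h
  obtain ⟨rfl | rfl | rfl, rfl | rfl | rfl⟩ := h <;>
    simp_all [Finset.pair_comm]

theorem exists_edge_of_subset_tri {s : Finset T22Vertex} (hs : s.card = 2) :
    ∀ {t : Option Edge}, s ⊆ tri t → ∃ e, s = edge e ∧ Incident e t
  | none, h => by
    rcases subset_three hs h with rfl | rfl | rfl
    · exact ⟨(0, []), rfl, Or.inl rfl⟩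
    · exact ⟨(2, []), Finset.pair_comm _ _, Or.inl rfl⟩
    · exact ⟨(1, []), Finset.pair_comm _ _, Or.inl rfl⟩
  | some (i, w), h => by
    rcases subset_three hs h with rfl | rfl | rfl
    · exact ⟨(i, w), rfl, Or.inr rfl⟩
    · exact ⟨(i, false :: w), rfl, Or.inl rfl⟩
    · exact ⟨(i, true :: w), rfl, Or.inl rfl⟩

theorem edge_subset_tri_some (e : Edge) : edge e ⊆ tri (some e) := by
  simp [edge, tri, Finset.insert_subset_iff]

theorem edge_subset_tri_parent : ∀ e : Edge, edge e ⊆ tri (parent e)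
  | (i, []) => by fin_cases i <;> simp [edge, tri, Finset.insert_subset_iff]
  | (i, false :: w) => by simp [edge, tri, Finset.insert_subset_iff]
  | (i, true :: w) => by simp [edge, tri, Finset.insert_subset_iff]

theorem edge_subset_tri_iff {e : Edge} {t : Option Edge} : edge e ⊆ tri t ↔ Incident e t := by
  refine ⟨fun h => ?_, fun h => ?_⟩
  · obtain ⟨e', h1, h2⟩ := exists_edge_of_subset_tri (card_edge e) h
    rwa [edge_injective h1]
  · rcases h with rfl | rfl
    · exact edge_subset_tri_parent e
    · exact edge_subset_tri_some e

theorem level_some (e : Edge) : level (some e) = level (parent e) + 1 := by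
  obtain ⟨i, _ | ⟨b, w⟩⟩ := e <;> rfl

theorem parent_ne_some (e : Edge) : parent e ≠ some e := fun h => by
  have := level_some e
  rw [h] at this
  omega

theorem depth_le_level {v : T22Vertex} {t : Option Edge} (h : v ∈ tri t) :
    depth v ≤ level t := by
  rcases t with _ | e
  · simp only [tri, Finset.mem_insert, Finset.mem_singleton] at h
    rcases h with rfl | rfl | rfl <;> exact le_rfl
  · simp only [tri, Finset.mem_insert, Finset.mem_singleton] at h
    rcases h with rfl | rfl | rfl
    · exact (depth_src_le e).trans (Nat.le_succ _)
    · exact (depth_tgt_le e).trans (Nat.le_succ _)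
    · exact le_rfl

theorem eq_of_tri_subset {t t' : Option Edge} (h : tri t = tri t') : t = t' := by
  have key : ∀ {e : Edge} {t : Option Edge}, tri (some e) = tri t → t = some e := by
    intro e t h
    have h1 : Sum.inr e ∈ tri t := by rw [← h]; simp [tri]
    have h2 := depth_le_level h1
    rcases t with _ | e'
    · simp [depth, level] at h2
    · have h3 : Sum.inr e' ∈ tri (some e) := by rw [h]; simp [tri]
      simp only [tri, Finset.mem_insert, Finset.mem_singleton] at h3
      have h4 : e'.2.length ≥ e.2.length := by simpa [depth, level] using h2
      rcases h3 with h3 | h3 | h3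
      · exact (src_ne_inr h4 h3.symm).elim
      · exact (tgt_ne_inr h4 h3.symm).elim
      · rw [Sum.inr.inj h3]
  rcases t with _ | e
  · rcases t' with _ | e'
    · rfl
    · exact key h.symm
  · exact (key h).symm

theorem tri_injective : Function.Injective tri := fun _ _ h => eq_of_tri_subset h

theorem mem_triangles_iff {s : Finset T22Vertex} : s ∈ triangles ↔ ∃ t, s = tri t := by
  constructor
  · rintro (rfl | ⟨i, w, rfl⟩)
    · exact ⟨none, rfl⟩
    · exact ⟨some (i, w), rfl⟩
  · rintro ⟨_ | ⟨i, w⟩, rfl⟩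
    · exact Or.inl rfl
    · exact Or.inr ⟨i, w, rfl⟩

theorem mem_faces_iff {s : Finset T22Vertex} :
    s ∈ T22.faces ↔ s.Nonempty ∧ ∃ t, s ⊆ tri t := by
  change (s.Nonempty ∧ ∃ t ∈ T22.triangles, s ⊆ t) ↔ _
  simp only [mem_triangles_iff]
  exact and_congr_right fun _ =>
    ⟨fun ⟨_, ⟨t, rfl⟩, h⟩ => ⟨t, h⟩, fun ⟨t, h⟩ => ⟨_, ⟨t, rfl⟩, h⟩⟩

theorem tri_mem_faces (t : Option Edge) : tri t ∈ T22.faces :=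
  mem_faces_iff.2 ⟨Finset.card_pos.1 (by rw [card_tri]; norm_num), t, subset_rfl⟩

theorem edge_mem_faces (e : Edge) : edge e ∈ T22.faces :=
  mem_faces_iff.2 ⟨Finset.card_pos.1 (by rw [card_edge]; norm_num), _, edge_subset_tri_some e⟩

theorem exists_edge_of_mem_faces {s : Finset T22Vertex} (h : s ∈ T22.faces) (hs : s.card = 2) :
    ∃ e, s = edge e := by
  obtain ⟨-, t, ht⟩ := mem_faces_iff.1 h
  obtain ⟨e, he, -⟩ := exists_edge_of_subset_tri hs ht
  exact ⟨e, he⟩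

theorem exists_tri_of_mem_faces {s : Finset T22Vertex} (h : s ∈ T22.faces) (hs : s.card = 3) :
    ∃ t, s = tri t := by
  obtain ⟨-, t, ht⟩ := mem_faces_iff.1 h
  exact ⟨t, Finset.eq_of_subset_of_card_le ht (by rw [hs, card_tri])⟩

theorem mem_cells_one_iff {s : Finset T22Vertex} : s ∈ T22.cells 1 ↔ ∃ e, s = edge e := by
  constructor
  · rintro ⟨h1, h2⟩
    exact exists_edge_of_mem_faces h1 h2
  · rintro ⟨e, rfl⟩
    exact ⟨edge_mem_faces e, card_edge e⟩

theorem mem_cells_two_iff {s : Finset T22Vertex} : s ∈ T22.cells 2 ↔ ∃ t, s = tri t := by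
  constructor
  · rintro ⟨h1, h2⟩
    exact exists_tri_of_mem_faces h1 h2
  · rintro ⟨t, rfl⟩
    exact ⟨tri_mem_faces t, card_tri t⟩

theorem edge_mem_cells (e : Edge) : edge e ∈ T22.cells 1 := mem_cells_one_iff.2 ⟨e, rfl⟩

theorem tri_mem_cells (t : Option Edge) : tri t ∈ T22.cells 2 := mem_cells_two_iff.2 ⟨t, rfl⟩

/-! ### `T22` is a `2`-regular arboreal triangle complex -/

theorem isTriangleComplex : T22.IsTriangleComplex := by
  refine ⟨⟨_, tri_mem_cells none⟩, fun s hs => ?_⟩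
  obtain ⟨-, t, ht⟩ := mem_faces_iff.1 hs
  exact ⟨_, tri_mem_cells t, ht⟩

theorem cofaces_edge (e : Edge) : T22.cofaces (edge e) = {tri (parent e), tri (some e)} := by
  ext s
  constructor
  · rintro ⟨h1, h2⟩
    obtain ⟨t, rfl⟩ := mem_cells_two_iff.1 h1
    rcases edge_subset_tri_iff.1 h2 with h | h
    · exact Or.inl (by rw [h])
    · exact Or.inr (by rw [h]; rfl)
  · rintro (rfl | rfl)
    · exact ⟨tri_mem_cells _, edge_subset_tri_parent e⟩
    · exact ⟨tri_mem_cells _, edge_subset_tri_some e⟩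

theorem isRegular : T22.IsRegular 2 := by
  intro s hs
  obtain ⟨e, rfl⟩ := mem_cells_one_iff.1 hs
  rw [cofaces_edge, Set.encard_pair fun h => parent_ne_some e (tri_injective h)]
  rfl

/-- Edges are adjacent exactly when they are different sides of one triangle. -/
theorem edgeGraph_adj_iff {e e' : Edge} :
    T22.edgeGraph.Adj (edge e) (edge e') ↔ e ≠ e' ∧ ∃ t, Incident e t ∧ Incident e' t := by
  constructor
  · intro h
    refine ⟨fun h' => h.ne (by rw [h']), ?_⟩
    obtain ⟨t, ht⟩ := mem_cells_two_iff.1 h.2.2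
    exact ⟨t, edge_subset_tri_iff.1 (ht ▸ Finset.subset_union_left),
      edge_subset_tri_iff.1 (ht ▸ Finset.subset_union_right)⟩
  · rintro ⟨hne, t, h, h'⟩
    refine ⟨edge_mem_cells e, edge_mem_cells e', mem_cells_two_iff.2 ⟨t, ?_⟩⟩
    refine Finset.eq_of_subset_of_card_le
      (Finset.union_subset (edge_subset_tri_iff.2 h) (edge_subset_tri_iff.2 h')) ?_
    rw [card_tri, Nat.succ_le_iff, ← card_edge e]
    refine Finset.card_lt_card ⟨Finset.subset_union_left, fun hsub => hne (edge_injective ?_)⟩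
    exact (Finset.eq_of_subset_of_card_le (Finset.subset_union_right.trans hsub)
      (by rw [card_edge, card_edge])).symm

theorem adj_cons (i : Fin 3) (b : Bool) (w : List Bool) :
    T22.edgeGraph.Adj (edge (i, w)) (edge (i, b :: w)) :=
  edgeGraph_adj_iff.2 ⟨by simp, some (i, w), Or.inr rfl, Or.inl rfl⟩

theorem isOneConnected : T22.IsOneConnected := by
  have key : ∀ (i : Fin 3) (w : List Bool),
      T22.edgeGraph.Reachable (edge (0, [])) (edge (i, w)) := by
    intro i w
    induction w with
    | nil =>
      by_cases h : (0 : Fin 3) = i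
      · rw [h]
      · exact (edgeGraph_adj_iff.2 ⟨by simpa using h, none, Or.inl rfl, Or.inl rfl⟩).reachable
    | cons b w ih => exact ih.trans (adj_cons i b w).reachable
  intro s hs s' hs'
  obtain ⟨⟨i, w⟩, rfl⟩ := mem_cells_one_iff.1 hs
  obtain ⟨⟨i', w'⟩, rfl⟩ := mem_cells_one_iff.1 hs'
  exact (key i w).symm.trans (key i' w')

/-- Two triangles that share an edge are the two triangles on that edge. -/
theorem exists_edge_of_card_inter {t t' : Option Edge} (h : (tri t ∩ tri t').card = 2) :
    ∃ e, (t = parent e ∧ t' = some e) ∨ (t = some e ∧ t' = parent e) := by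
  have hne : t ≠ t' := by
    rintro rfl
    rw [Finset.inter_self, card_tri] at h
    omega
  obtain ⟨e, he, h1⟩ := exists_edge_of_subset_tri h Finset.inter_subset_left
  have h2 : Incident e t' := edge_subset_tri_iff.1 (he ▸ Finset.inter_subset_right)
  refine ⟨e, ?_⟩
  rcases h1 with h1 | h1 <;> rcases h2 with h2 | h2
  · exact (hne (h1.symm.trans h2)).elim
  · exact Or.inl ⟨h1.symm, h2.symm⟩
  · exact Or.inr ⟨h1.symm, h2.symm⟩
  · exact (hne (h1.symm.trans h2)).elim

/-- A chain of triangles that once moves away from the first triangle can only come back by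
backtracking. -/
theorem level_lt_of_chain {n : ℕ} {τ : ℕ → Option Edge}
    (hadj : ∀ i < n, ∃ e, (τ i = parent e ∧ τ (i + 1) = some e) ∨
      (τ i = some e ∧ τ (i + 1) = parent e))
    (hback : ∀ i, i + 2 ≤ n → τ i ≠ τ (i + 2)) {k : ℕ}
    (hup : level (τ k) < level (τ (k + 1))) :
    ∀ j, k < j → j ≤ n → level (τ k) < level (τ j) ∧ level (τ (j - 1)) < level (τ j) := by
  intro j hkj
  induction j, hkj using Nat.le_induction with
  | base => exact fun _ => ⟨hup, hup⟩
  | succ j hkj ih =>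
    intro hj
    obtain ⟨h1, h2⟩ := ih (by omega)
    obtain ⟨m, rfl⟩ : ∃ m, j = m + 1 := ⟨j - 1, by omega⟩
    obtain ⟨e, he | he⟩ := hadj (m + 1) (by omega)
    · have := level_some e
      rw [← he.1, ← he.2] at this
      simp only [Nat.add_sub_cancel]
      omega
    · exfalso
      obtain ⟨e', he' | he'⟩ := hadj m (by omega)
      · have h3 : e = e' := Option.some.inj (he.1.symm.trans he'.2)
        exact hback m hj (by rw [he'.1, he.2, h3])
      · have := level_some e'
        rw [← he'.1, ← he'.2] at this
        simp only [Nat.add_sub_cancel] at h2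
        omega

/-- There are no closed chains without backtracking, by induction on the length: the first step
of such a chain goes to the parent and the last one comes from it, so that a shorter chain remains
when both are removed. -/
theorem not_exists_closed_chain (n : ℕ) : 1 ≤ n → ∀ τ : ℕ → Option Edge,
    (∀ i < n, ∃ e, (τ i = parent e ∧ τ (i + 1) = some e) ∨ (τ i = some e ∧ τ (i + 1) = parent e)) →
    (∀ i, i + 2 ≤ n → τ i ≠ τ (i + 2)) → τ n ≠ τ 0 := by
  induction n using Nat.strong_induction_on with
  | _ n ih =>
    intro hn τ hadj hback hclosed
    obtain ⟨e, he⟩ := hadj 0 hn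
    obtain ⟨m, rfl⟩ : ∃ m, n = m + 1 := ⟨n - 1, by omega⟩
    rcases he with he | he
    · have hup : level (τ 0) < level (τ (0 + 1)) := by
        rw [he.1, he.2, level_some]; omega
      have := (level_lt_of_chain hadj hback hup (m + 1) (by omega) le_rfl).1
      rw [hclosed] at this
      omega
    · obtain ⟨e', he'⟩ := hadj m (by omega)
      rcases he' with he' | he'
      · have hee : e = e' := by
          have := he'.2
          rw [hclosed, he.1] at this
          exact Option.some.inj this
        subst hee
        have hm : τ m = τ 1 := by rw [he'.1]; exact he.2.symm
        have hm1 : m ≠ 0 := by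
          rintro rfl
          have := he'.1
          rw [he.1] at this
          exact parent_ne_some e this.symm
        have hm2 : m ≠ 1 := by
          rintro rfl
          exact hback 0 (by omega) hclosed.symm
        obtain ⟨p, rfl⟩ : ∃ p, m = p + 2 := ⟨m - 2, by omega⟩
        refine ih (p + 1) (by omega) (by omega) (fun i => τ (i + 1)) (fun i hi => ?_)
          (fun i hi => ?_) hm
        · exact hadj (i + 1) (by omega)
        · exact hback (i + 1) (by omega)
      · -- if the last step goes down, all steps go down
        have hdown : ∀ k ≤ m, level (τ (k + 1)) < level (τ k) := by
          intro k hk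
          by_contra hcon
          obtain ⟨e'', h | h⟩ := hadj k (by omega)
          · have hup : level (τ k) < level (τ (k + 1)) := by
              rw [h.1, h.2, level_some]; omega
            have := (level_lt_of_chain hadj hback hup (m + 1) (by omega) le_rfl).2
            have h' := level_some e'
            rw [← he'.1, ← he'.2] at h'
            simp only [Nat.add_sub_cancel] at this
            omega
          · apply hcon
            rw [h.1, h.2, level_some]; omega
        have : ∀ k ≤ m, level (τ (k + 1)) < level (τ 0) := by
          intro k
          induction k with
          | zero => exact fun h => hdown 0 h
          | succ k ihk => exact fun h => (hdown (k + 1) h).trans (ihk (by omega))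
        have := this m le_rfl
        rw [hclosed] at this
        omega

theorem not_hasSimpleLoop : ¬ T22.HasSimpleLoop := by
  rintro ⟨n, σ, hn, hσ, hadj, hback, hclosed⟩
  have h : ∀ i, ∃ t, i ≤ n → σ i = tri t := fun i => by
    by_cases hi : i ≤ n
    · obtain ⟨t, ht⟩ := mem_cells_two_iff.1 (hσ i hi)
      exact ⟨t, fun _ => ht⟩
    · exact ⟨none, fun h => (hi h).elim⟩
  choose τ hτ using h
  refine not_exists_closed_chain n hn τ (fun i hi => ?_) (fun i hi h => ?_) ?_
  · refine exists_edge_of_card_inter ?_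
    rw [← hτ i hi.le, ← hτ (i + 1) hi]
    exact hadj i hi
  · exact hback i hi (by rw [hτ i (by omega), hτ (i + 2) hi, h])
  · exact tri_injective (by rw [← hτ n le_rfl, ← hτ 0 (Nat.zero_le n), hclosed])

theorem isArboreal : T22.IsArboreal := ⟨isTriangleComplex, isOneConnected, not_hasSimpleLoop⟩

end T22

/-! ### Sums over the labels -/

namespace T22

/-- The two edges that appear together with the triangle attached to `e`. -/
def child (b : Bool) (e : Edge) : Edge := (e.1, b :: e.2)

@[simp] theorem parent_child (b : Bool) (e : Edge) : parent (child b e) = some e := rfl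

theorem child_injective (b : Bool) : Function.Injective (child b) := by
  rintro ⟨i, w⟩ ⟨i', w'⟩ h
  simpa [child] using h

/-- An edge is a side of the first triangle or a child of another edge. -/
def edgeEquiv : Fin 3 ⊕ (Edge ⊕ Edge) ≃ Edge where
  toFun := Sum.elim (fun i => (i, [])) (Sum.elim (child false) (child true))
  invFun
    | (i, []) => Sum.inl i
    | (i, false :: w) => Sum.inr (Sum.inl (i, w))
    | (i, true :: w) => Sum.inr (Sum.inr (i, w))
  left_inv := by rintro (i | ⟨i, w⟩ | ⟨i, w⟩) <;> rfl
  right_inv := by rintro ⟨i, _ | ⟨_ | _, w⟩⟩ <;> rfl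

theorem hasSum_edge {G : Edge → ℝ} {s s' : ℝ} (h : HasSum (fun e => G (child false e)) s)
    (h' : HasSum (fun e => G (child true e)) s') :
    HasSum G ((G (0, []) + G (1, []) + G (2, [])) + (s + s')) := by
  refine edgeEquiv.hasSum_iff.1 (HasSum.sum ?_ (HasSum.sum h h'))
  rw [← Fin.sum_univ_three fun i => G (i, [])]
  exact hasSum_fintype _

theorem hasSum_option {α : Type*} {K : Option α → ℝ} {s : ℝ}
    (h : HasSum (fun a => K (some a)) s) : HasSum K (s + K none) :=
  (Equiv.optionEquivSumPUnit.{0} α).symm.hasSum_iff.1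
    (HasSum.sum h (hasSum_unique (β := PUnit.{1}) _))

/-- Every triangle has two edges that it is the parent of, and the first triangle has three. -/
theorem hasSum_parent {K : Option Edge → ℝ} {s : ℝ} (h : HasSum (fun e => K (some e)) s) :
    HasSum (fun e => K (parent e)) (3 * K none + 2 * s) := by
  convert hasSum_edge (G := fun e => K (parent e)) h h using 1
  simp only [parent_nil]
  ring

theorem summable_mul_of_sq {α : Type*} {a b : α → ℝ} (ha : Summable fun i => a i ^ 2)
    (hb : Summable fun i => b i ^ 2) : Summable fun i => a i * b i := by
  simpa using PreAbstractSimplicialComplex.summable_cross (w := fun _ : α => (1 : ℝ))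
    (a := a) (b := b) (fun _ => one_pos) (by simpa using ha) (by simpa using hb)

theorem summable_add_sq' {α : Type*} {a b : α → ℝ} (ha : Summable fun i => a i ^ 2)
    (hb : Summable fun i => b i ^ 2) : Summable fun i => (a i + b i) ^ 2 := by
  simpa using PreAbstractSimplicialComplex.summable_add_sq (w := fun _ : α => (1 : ℝ))
    (a := a) (b := b) (fun _ => one_pos) (by simpa using ha) (by simpa using hb)

/-- The boundary of a `2`-form, in terms of labels: with the orientations chosen here, an edge is
positively oriented in the triangle it appeared with, and negatively in the triangle attached to
it. -/
def bdry (F : Option Edge → ℝ) (e : Edge) : ℝ := F (parent e) - F (some e)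

/-- The sum of a function of the oriented edges along the boundary of a triangle, in terms of
labels. -/
def cobdry (φ : Edge → ℝ) : Option Edge → ℝ
  | none => φ (0, []) + φ (1, []) + φ (2, [])
  | some e => φ (child false e) + φ (child true e) - φ e

theorem summable_cobdry_sq {φ : Edge → ℝ} (hφ : Summable fun e => φ e ^ 2) :
    Summable fun t => cobdry φ t ^ 2 := by
  refine (hasSum_option (Summable.hasSum ?_)).summable
  have h0 : Summable fun e => (-φ e) ^ 2 := by simpa using hφ
  exact summable_add_sq' (summable_add_sq' (hφ.comp_injective (child_injective false))
    (hφ.comp_injective (child_injective true))) h0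

theorem summable_some {F : Option Edge → ℝ} (hF : Summable fun t => F t ^ 2) :
    Summable fun e => F (some e) ^ 2 := hF.comp_injective (Option.some_injective _)

theorem summable_parent {F : Option Edge → ℝ} (hF : Summable fun t => F t ^ 2) :
    Summable fun e => F (parent e) ^ 2 :=
  (hasSum_parent (K := fun t => F t ^ 2) (summable_some hF).hasSum).summable

theorem summable_bdry_sq {F : Option Edge → ℝ} (hF : Summable fun t => F t ^ 2) :
    Summable fun e => bdry F e ^ 2 := by
  have h0 : Summable fun e => (-F (some e)) ^ 2 := by simpa using summable_some hF
  simpa only [bdry, sub_eq_add_neg] using summable_add_sq' (summable_parent hF) h0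

theorem tsum_option_sq {F : Option Edge → ℝ} (hF : Summable fun t => F t ^ 2) :
    ∑' t, F t ^ 2 = (∑' e, F (some e) ^ 2) + F none ^ 2 :=
  (hasSum_option (K := fun t => F t ^ 2) (summable_some hF).hasSum).tsum_eq

theorem tsum_parent_sq {F : Option Edge → ℝ} (hF : Summable fun t => F t ^ 2) :
    ∑' e, F (parent e) ^ 2 = 3 * F none ^ 2 + 2 * ∑' e, F (some e) ^ 2 :=
  (hasSum_parent (K := fun t => F t ^ 2) (summable_some hF).hasSum).tsum_eq

theorem tsum_bdry_sq_le {F : Option Edge → ℝ} (hF : Summable fun t => F t ^ 2) :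
    ∑' e, bdry F e ^ 2 ≤ 8 * ∑' t, F t ^ 2 := by
  have h1 := summable_parent hF
  have h2 := summable_some hF
  calc ∑' e, bdry F e ^ 2 ≤ ∑' e, (2 * F (parent e) ^ 2 + 2 * F (some e) ^ 2) := by
        refine (summable_bdry_sq hF).tsum_le_tsum (fun e => ?_)
          ((h1.mul_left 2).add (h2.mul_left 2))
        rw [bdry]
        nlinarith [sq_nonneg (F (parent e) + F (some e))]
    _ ≤ 8 * ∑' t, F t ^ 2 := by
        rw [(h1.mul_left 2).tsum_add (h2.mul_left 2), tsum_mul_left, tsum_mul_left,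
          tsum_parent_sq hF, tsum_option_sq hF]
        have h0 : 0 ≤ ∑' e, F (some e) ^ 2 := tsum_nonneg fun e => sq_nonneg _
        nlinarith [sq_nonneg (F none)]

/-- The tree of triangles is `3`-regular, so that its adjacency operator has norm at most `2 √2`;
hence the operator `3 - A` is at least `3 - 2 √2`. The weights `1 / √2` and `√2` in the inequality
`2 x y ≤ x ^ 2 / √2 + √2 y ^ 2`, used for the value `x` at the parent, reflect the growth of the
tree. -/
theorem le_tsum_bdry_sq {F : Option Edge → ℝ} (hF : Summable fun t => F t ^ 2) :
    (3 - 2 * √2) * ∑' t, F t ^ 2 ≤ ∑' e, bdry F e ^ 2 := by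
  have h1 := summable_parent hF
  have h2 := summable_some hF
  have hs : √2 * √2 = (2 : ℝ) := Real.mul_self_sqrt (by norm_num)
  have hs1 : (1 : ℝ) ≤ √2 := Real.one_le_sqrt.2 (by norm_num)
  have hs2 : √2 ≤ (3 / 2 : ℝ) := by nlinarith
  calc (3 - 2 * √2) * ∑' t, F t ^ 2
      ≤ ∑' e, ((1 - √2 / 2) * F (parent e) ^ 2 + (1 - √2) * F (some e) ^ 2) := by
        rw [(h1.mul_left _).tsum_add (h2.mul_left _), tsum_mul_left, tsum_mul_left,
          tsum_parent_sq hF, tsum_option_sq hF]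
        nlinarith [sq_nonneg (F none)]
    _ ≤ ∑' e, bdry F e ^ 2 := by
        refine ((h1.mul_left _).add (h2.mul_left _)).tsum_le_tsum (fun e => ?_)
          (summable_bdry_sq hF)
        rw [bdry]
        nlinarith [mul_nonneg (Real.sqrt_nonneg 2) (sq_nonneg (F (parent e) - √2 * F (some e)))]

/-- The boundary and the coboundary operator are adjoint. -/
theorem tsum_mul_bdry {φ : Edge → ℝ} {F : Option Edge → ℝ} (hφ : Summable fun e => φ e ^ 2)
    (hF : Summable fun t => F t ^ 2) :
    ∑' e, φ e * bdry F e = ∑' t, F t * cobdry φ t := by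
  have hF' := summable_some hF
  have h1 := summable_mul_of_sq (hφ.comp_injective (child_injective false)) hF'
  have h2 := summable_mul_of_sq (hφ.comp_injective (child_injective true)) hF'
  have h3 := summable_mul_of_sq hφ hF'
  have hp := hasSum_edge (G := fun e => φ e * F (parent e)) h1.hasSum h2.hasSum
  have hl := hp.sub h3.hasSum
  have hr := hasSum_option (K := fun t => F t * cobdry φ t)
    (((h1.hasSum.add h2.hasSum).sub h3.hasSum).congr_fun fun e => by
      simp only [cobdry]; ring)
  rw [hr.tsum_eq, (hl.congr_fun (g := fun e => φ e * bdry F e) fun e => by rw [bdry]; ring).tsum_eq]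
  simp only [parent_nil, cobdry]
  ring

/-! ### Forms on `T22` in terms of labels -/

/-- The antisymmetric functions of two vertices that vanish unless these span an edge. -/
def IsForm (f : T22Vertex → T22Vertex → ℝ) : Prop :=
  (∀ v w, f w v = - f v w) ∧ ∀ v w, (∀ e, edge e ≠ {v, w}) → f v w = 0

theorem edge_cases (v w : T22Vertex) :
    (∃ e, v = src e ∧ w = tgt e) ∨ (∃ e, w = src e ∧ v = tgt e) ∨ ∀ e, edge e ≠ {v, w} := by
  by_cases h : ∃ e, edge e = {v, w}
  · obtain ⟨e, he⟩ := h
    rcases edge_eq_pair_iff.1 he with ⟨h1, h2⟩ | ⟨h1, h2⟩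
    · exact Or.inl ⟨e, h1.symm, h2.symm⟩
    · exact Or.inr (Or.inl ⟨e, h1.symm, h2.symm⟩)
  · exact Or.inr (Or.inr (by simpa using h))

theorem IsForm.ext {f g : T22Vertex → T22Vertex → ℝ} (hf : IsForm f) (hg : IsForm g)
    (h : ∀ e, f (src e) (tgt e) = g (src e) (tgt e)) (v w : T22Vertex) : f v w = g v w := by
  rcases edge_cases v w with ⟨e, rfl, rfl⟩ | ⟨e, rfl, rfl⟩ | h'
  · exact h e
  · rw [hf.1, hg.1, h]
  · rw [hf.2 v w h', hg.2 v w h']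

/-- The form with given values on the oriented edges. -/
def toForm (h : Edge → ℝ) (v w : T22Vertex) : ℝ :=
  Function.extend (fun e => (src e, tgt e)) h 0 (v, w) -
    Function.extend (fun e => (src e, tgt e)) h 0 (w, v)

theorem toForm_edge (h : Edge → ℝ) (e : Edge) : toForm h (src e) (tgt e) = h e := by
  rw [toForm, ends_injective.extend_apply h 0 e, Function.extend_apply', Pi.zero_apply, sub_zero]
  rintro ⟨e', he'⟩
  exact ends_ne_swap e' e he'

theorem isForm_toForm (h : Edge → ℝ) : IsForm (toForm h) := by
  refine ⟨fun v w => by rw [toForm, toForm]; ring, fun v w h' => ?_⟩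
  rw [toForm, Function.extend_apply', Function.extend_apply', Pi.zero_apply, Pi.zero_apply, sub_self]
  · rintro ⟨e, he⟩
    exact h' e (edge_eq_pair_iff.2 (Or.inr (by simpa using he)))
  · rintro ⟨e, he⟩
    exact h' e (edge_eq_pair_iff.2 (Or.inl (by simpa using he)))

theorem hasSum_pairs {G : T22Vertex × T22Vertex → ℝ} (hsymm : ∀ v w, G (w, v) = G (v, w))
    (hG : ∀ v w, (∀ e, edge e ≠ {v, w}) → G (v, w) = 0) {s : ℝ}
    (h : HasSum (fun e => G (src e, tgt e)) s) : HasSum G (2 * s) := by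
  set G' : T22Vertex × T22Vertex → ℝ :=
    Function.extend (fun e : Edge => (src e, tgt e)) (fun e => G (src e, tgt e)) 0 with hG'
  have h1 : HasSum G' s := by
    refine (ends_injective.hasSum_iff fun p hp => ?_).1 (h.congr_fun fun e => ?_)
    · exact Function.extend_apply' _ _ _ hp
    · exact ends_injective.extend_apply (fun e => G (src e, tgt e)) 0 e
  have h2 : HasSum (fun p : T22Vertex × T22Vertex => G' p.swap) s := (Equiv.prodComm _ _).hasSum_iff.2 h1
  rw [two_mul]
  refine (h1.add h2).congr_fun fun p => ?_
  obtain ⟨v, w⟩ := p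
  have hv : ∀ e, G' (src e, tgt e) = G (src e, tgt e) := fun e =>
    ends_injective.extend_apply _ _ e
  have hv' : ∀ e, G' (tgt e, src e) = 0 := fun e =>
    Function.extend_apply' _ _ _ fun ⟨e', he'⟩ => ends_ne_swap e' e he'
  rcases edge_cases v w with ⟨e, rfl, rfl⟩ | ⟨e, rfl, rfl⟩ | h'
  · simp [hv, hv']
  · simp [hv, hv', hsymm]
  · rw [hG v w h', hG', Function.extend_apply', Function.extend_apply']
    · simp
    · rintro ⟨e, he⟩
      exact h' e (edge_eq_pair_iff.2 (Or.inr (by simpa using he)))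
    · rintro ⟨e, he⟩
      exact h' e (edge_eq_pair_iff.2 (Or.inl (by simpa using he)))

end T22

/-! ### Boundary and coboundary operators of a subcomplex of `T22` -/

namespace T22

open PreAbstractSimplicialComplex

variable {X : PreAbstractSimplicialComplex T22Vertex}

theorem edge_mem_of_incident {e : Edge} {t : Option Edge} (h : Incident e t)
    (ht : tri t ∈ X.faces) : edge e ∈ X.faces :=
  (X.isRelLowerSet_faces ht).2 (edge_subset_tri_iff.2 h)
    (Finset.card_pos.1 (by rw [card_edge]; norm_num))

theorem edge_mem_cells_iff {e : Edge} : edge e ∈ X.cells 1 ↔ edge e ∈ X.faces :=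
  ⟨fun h => h.1, fun h => ⟨h, card_edge e⟩⟩

theorem tri_mem_cells_iff {t : Option Edge} : tri t ∈ X.cells 2 ↔ tri t ∈ X.faces :=
  ⟨fun h => h.1, fun h => ⟨h, card_tri t⟩⟩

theorem weight_le_one (s : Finset T22Vertex) : X.weight s ≤ 1 :=
  inv_le_one_of_one_le₀ (le_max_left _ _)

theorem cofaces_edge_subset (hX : X ≤ T22) (e : Edge) :
    X.cofaces (edge e) ⊆ {tri (parent e), tri (some e)} := by
  rw [← cofaces_edge]
  exact fun s hs => ⟨⟨hX hs.1.1, hs.1.2⟩, hs.2⟩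

theorem half_le_weight (hX : X ≤ T22) (e : Edge) : 1 / 2 ≤ X.weight (edge e) := by
  rw [weight, one_div]
  have h : X.deg (edge e) ≤ 2 := (Set.ncard_le_ncard (cofaces_edge_subset hX e)
    (Set.toFinite _)).trans
    ((Set.ncard_insert_le _ _).trans (by rw [Set.ncard_singleton]))
  refine inv_anti₀ (lt_of_lt_of_le one_pos (le_max_left _ _)) (max_le (by norm_num) ?_)
  exact_mod_cast h

theorem weight_eq_half (hX : X ≤ T22) {e : Edge} (h1 : tri (parent e) ∈ X.faces)
    (h2 : tri (some e) ∈ X.faces) : X.weight (edge e) = 1 / 2 := by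
  have h : X.cofaces (edge e) = {tri (parent e), tri (some e)} := by
    refine (cofaces_edge_subset hX e).antisymm ?_
    rintro s (rfl | rfl)
    · exact ⟨⟨h1, card_tri _⟩, edge_subset_tri_parent e⟩
    · exact ⟨⟨h2, card_tri _⟩, edge_subset_tri_some e⟩
  rw [weight, deg, h, Set.ncard_pair fun h => parent_ne_some e (tri_injective h)]
  norm_num

theorem isForm_l2Form (hX : X ≤ T22) (f : X.L2Form) : IsForm f := by
  refine ⟨f.2.1, fun v w h => f.2.2.1 v w fun h' => ?_⟩
  obtain ⟨e, he⟩ := exists_edge_of_mem_faces (hX h'.1) h'.2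
  exact h e he.symm

/-- The form `f / deg`, in terms of labels. -/
def scaled (f : X.L2Form) (e : Edge) : ℝ := X.weight (edge e) * f (src e) (tgt e)

theorem summable_weight_mul_sq (f : X.L2Form) :
    Summable fun e => X.weight (edge e) * f (src e) (tgt e) ^ 2 :=
  f.2.2.2.comp_injective ends_injective

theorem summable_scaled_sq (f : X.L2Form) : Summable fun e => scaled f e ^ 2 := by
  refine (summable_weight_mul_sq f).of_nonneg_of_le (fun e => sq_nonneg _) fun e => ?_
  have h1 := X.weight_pos (edge e)
  have h2 := weight_le_one (X := X) (edge e)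
  calc scaled f e ^ 2
      = X.weight (edge e) * (X.weight (edge e) * f (src e) (tgt e) ^ 2) := by rw [scaled]; ring
    _ ≤ 1 * (X.weight (edge e) * f (src e) (tgt e) ^ 2) := by gcongr
    _ = _ := one_mul _

theorem inner_eq_tsum (hX : X ≤ T22) (f g : X.L2Form) :
    inner ℝ f g = ∑' e, scaled f e * g (src e) (tgt e) := by
  have hf := isForm_l2Form hX f
  have hg := isForm_l2Form hX g
  set G : T22Vertex × T22Vertex → ℝ := fun p => X.weight {p.1, p.2} * (f p.1 p.2 * g p.1 p.2)
    with hG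
  have hs : Summable G :=
    summable_cross (fun p : T22Vertex × T22Vertex => X.weight_pos {p.1, p.2}) f.2.2.2 g.2.2.2
  have h : HasSum (fun e => G (src e, tgt e)) (∑' e, G (src e, tgt e)) :=
    (hs.comp_injective ends_injective).hasSum
  have h1 : ∀ v w, G (w, v) = G (v, w) := fun v w => by
    simp only [hG]
    rw [hf.1 v w, hg.1 v w, Finset.pair_comm]
    ring
  have h2 : ∀ v w, (∀ e, edge e ≠ {v, w}) → G (v, w) = 0 := fun v w h' => by
    simp only [hG]
    rw [hf.2 v w h']
    ring
  have h3 : inner ℝ f g = (1 / 2) * ∑' p, G p := rfl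
  rw [h3, (hasSum_pairs h1 h2 h).tsum_eq, ← mul_assoc, show (1 / 2 : ℝ) * 2 = 1 by norm_num,
    one_mul]
  exact tsum_congr fun e => (mul_assoc _ _ _).symm

/-- The square-summable form with given values on the oriented edges. -/
def ofEdges (h : Edge → ℝ) (h0 : ∀ e, edge e ∉ X.faces → h e = 0)
    (hs : Summable fun e => h e ^ 2) : X.L2Form :=
  ⟨toForm h, (isForm_toForm h).1, fun v w hvw => by
    rcases edge_cases v w with ⟨e, rfl, rfl⟩ | ⟨e, rfl, rfl⟩ | h'
    · rw [toForm_edge]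
      exact h0 e fun h => hvw (edge_mem_cells_iff.2 h)
    · rw [(isForm_toForm h).1, toForm_edge, h0 e, neg_zero]
      exact fun h => hvw (by rw [Finset.pair_comm]; exact edge_mem_cells_iff.2 h)
    · exact (isForm_toForm h).2 v w h', by
    refine (hasSum_pairs (fun v w => ?_) (fun v w h' => ?_) (Summable.hasSum ?_)).summable
    · simp only [sqTerm]
      rw [(isForm_toForm h).1 v w, Finset.pair_comm, neg_sq]
    · simp only [sqTerm]
      rw [(isForm_toForm h).2 v w h']
      ring
    · refine hs.of_nonneg_of_le (fun e => ?_) fun e => ?_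
      · exact mul_nonneg (X.weight_pos _).le (sq_nonneg _)
      · simp only [sqTerm, toForm_edge]
        exact mul_le_of_le_one_left (sq_nonneg _) (weight_le_one _)⟩

theorem ofEdges_apply {h : Edge → ℝ} (h0 : ∀ e, edge e ∉ X.faces → h e = 0)
    (hs : Summable fun e => h e ^ 2) (e : Edge) : ofEdges h h0 hs (src e) (tgt e) = h e :=
  toForm_edge h e

theorem l2Form_ext (hX : X ≤ T22) {f g : X.L2Form}
    (h : ∀ e, f (src e) (tgt e) = g (src e) (tgt e)) : f = g :=
  Subtype.ext (funext fun v => funext fun w =>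
    (isForm_l2Form hX f).ext (isForm_l2Form hX g) h v w)

/-- The Hilbert space of square-summable `2`-forms: functions of the triangles of the complex, all
oriented as in `T22.cobdry`. -/
abbrev TwoForm (X : PreAbstractSimplicialComplex T22Vertex) : Type :=
  lp (fun _ : {t : Option Edge // tri t ∈ X.faces} => ℝ) 2

open Classical in
/-- Extension of a `2`-form by zero. -/
def extend (F : TwoForm X) (t : Option Edge) : ℝ := if h : tri t ∈ X.faces then F ⟨t, h⟩ else 0

theorem extend_coe (F : TwoForm X) (t : {t : Option Edge // tri t ∈ X.faces}) :
    extend F t = F t := dif_pos t.2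

theorem extend_of_notMem (F : TwoForm X) {t : Option Edge} (h : tri t ∉ X.faces) :
    extend F t = 0 := dif_neg h

theorem hasSum_extend_mul {F : TwoForm X} {K : Option Edge → ℝ} {s : ℝ} :
    HasSum (fun t => extend F t * K t) s ↔
      HasSum (fun t : {t : Option Edge // tri t ∈ X.faces} => F t * K t) s := by
  rw [← Subtype.val_injective.hasSum_iff fun t ht => ?_]
  · exact iff_of_eq (congrArg (HasSum · s _) (funext fun t => by
      simp only [Function.comp_apply, extend_coe]))
  · rw [extend_of_notMem F fun h => ht ⟨⟨t, h⟩, rfl⟩, zero_mul]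

theorem hasSum_extend_sq (F : TwoForm X) : HasSum (fun t => extend F t ^ 2) (‖F‖ ^ 2) := by
  rw [← real_inner_self_eq_norm_sq]
  refine (hasSum_extend_mul.2 ((lp.hasSum_inner F F).congr_fun fun t => ?_)).congr_fun
    (fun t => sq (extend F t))
  rw [extend_coe]
  rfl

theorem extend_add (F G : TwoForm X) (t : Option Edge) :
    extend (F + G) t = extend F t + extend G t := by
  unfold extend
  split_ifs
  · rfl
  · simp

theorem extend_smul (c : ℝ) (F : TwoForm X) (t : Option Edge) :
    extend (c • F) t = c * extend F t := by
  unfold extend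
  split_ifs
  · rfl
  · simp

theorem bdry_extend_eq_zero (F : TwoForm X) (e : Edge) (h : edge e ∉ X.faces) :
    bdry (extend F) e = 0 := by
  rw [bdry, extend_of_notMem F fun h' => h (edge_mem_of_incident (Or.inl rfl) h'),
    extend_of_notMem F fun h' => h (edge_mem_of_incident (Or.inr rfl) h'), sub_zero]

theorem norm_sq_eq_tsum (hX : X ≤ T22) (f : X.L2Form) :
    ‖f‖ ^ 2 = ∑' e, X.weight (edge e) * f (src e) (tgt e) ^ 2 := by
  rw [← real_inner_self_eq_norm_sq, inner_eq_tsum hX]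
  exact tsum_congr fun e => by rw [scaled]; ring

/-- The boundary operator from `2`-forms to `1`-forms, before its continuity is known. -/
def boundaryₗ (hX : X ≤ T22) : TwoForm X →ₗ[ℝ] X.L2Form where
  toFun F := ofEdges (bdry (extend F)) (bdry_extend_eq_zero F)
    (summable_bdry_sq (hasSum_extend_sq F).summable)
  map_add' F G := l2Form_ext hX fun e => by
    change _ = ofEdges _ _ _ (src e) (tgt e) + ofEdges _ _ _ (src e) (tgt e)
    simp only [ofEdges_apply, bdry, extend_add]
    ring
  map_smul' c F := l2Form_ext hX fun e => by
    change _ = c * ofEdges _ _ _ (src e) (tgt e)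
    simp only [ofEdges_apply, bdry, extend_smul]
    ring

theorem boundaryₗ_apply (hX : X ≤ T22) (F : TwoForm X) (e : Edge) :
    boundaryₗ hX F (src e) (tgt e) = bdry (extend F) e := ofEdges_apply (bdry_extend_eq_zero F) (summable_bdry_sq (hasSum_extend_sq F).summable) e

theorem norm_sq_boundaryₗ (hX : X ≤ T22) (F : TwoForm X) :
    ‖boundaryₗ hX F‖ ^ 2 = ∑' e, X.weight (edge e) * bdry (extend F) e ^ 2 := by
  rw [norm_sq_eq_tsum hX]
  simp only [boundaryₗ_apply]

theorem summable_weight_mul_bdry_sq (F : TwoForm X) :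
    Summable fun e => X.weight (edge e) * bdry (extend F) e ^ 2 :=
  (summable_bdry_sq (hasSum_extend_sq F).summable).of_nonneg_of_le
    (fun _ => mul_nonneg (X.weight_pos _).le (sq_nonneg _))
    fun _ => mul_le_of_le_one_left (sq_nonneg _) (weight_le_one _)

/-- The boundary operator from `2`-forms to `1`-forms. -/
def boundary (hX : X ≤ T22) : TwoForm X →L[ℝ] X.L2Form :=
  (boundaryₗ hX).mkContinuous 3 fun F => by
    refine abs_le_of_sq_le_sq' ?_ (by positivity) |>.2
    have hF := hasSum_extend_sq F
    calc ‖boundaryₗ hX F‖ ^ 2 ≤ ∑' e, bdry (extend F) e ^ 2 := by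
          rw [norm_sq_boundaryₗ]
          exact (summable_weight_mul_bdry_sq F).tsum_le_tsum
            (fun e => mul_le_of_le_one_left (sq_nonneg _) (weight_le_one _))
            (summable_bdry_sq hF.summable)
      _ ≤ 8 * ‖F‖ ^ 2 := by
          rw [← hF.tsum_eq]
          exact tsum_bdry_sq_le hF.summable
      _ ≤ (3 * ‖F‖) ^ 2 := by nlinarith [sq_nonneg ‖F‖]

theorem boundary_apply (hX : X ≤ T22) (F : TwoForm X) (e : Edge) :
    boundary hX F (src e) (tgt e) = bdry (extend F) e := boundaryₗ_apply hX F e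

theorem norm_sq_boundary (hX : X ≤ T22) (F : TwoForm X) :
    ‖boundary hX F‖ ^ 2 = ∑' e, X.weight (edge e) * bdry (extend F) e ^ 2 :=
  norm_sq_boundaryₗ hX F

theorem scaled_add (f g : X.L2Form) (e : Edge) : scaled (f + g) e = scaled f e + scaled g e :=
  mul_add _ _ _

theorem scaled_smul (c : ℝ) (f : X.L2Form) (e : Edge) : scaled (c • f) e = c * scaled f e :=
  mul_left_comm _ _ _

/-- The coboundary operator from `1`-forms to `2`-forms, before its continuity is known. -/
def coboundaryₗ : X.L2Form →ₗ[ℝ] TwoForm X where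
  toFun f := ⟨fun t => cobdry (scaled f) t, memℓp_gen (by
    simp only [Real.norm_eq_abs, ENNReal.toReal_ofNat, Real.rpow_ofNat, sq_abs]
    exact (summable_cobdry_sq (summable_scaled_sq f)).comp_injective Subtype.val_injective)⟩
  map_add' f g := by
    refine lp.ext (funext fun t => ?_)
    change cobdry (scaled (f + g)) t = cobdry (scaled f) t + cobdry (scaled g) t
    obtain ⟨_ | e, ht⟩ := t <;> simp only [cobdry, scaled_add] <;> ring
  map_smul' c f := by
    refine lp.ext (funext fun t => ?_)
    change cobdry (scaled (c • f)) t = c * cobdry (scaled f) t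
    obtain ⟨_ | e, ht⟩ := t <;> simp only [cobdry, scaled_smul] <;> ring

theorem inner_boundary_coboundaryₗ (hX : X ≤ T22) (F : TwoForm X) (f : X.L2Form) :
    inner ℝ (boundary hX F) f = inner ℝ F (coboundaryₗ f) := by
  have hf := summable_scaled_sq f
  have hF := (hasSum_extend_sq F).summable
  rw [real_inner_comm, inner_eq_tsum hX]
  simp only [boundary_apply]
  rw [tsum_mul_bdry hf hF]
  have h := (summable_mul_of_sq hF (summable_cobdry_sq hf)).hasSum
  rw [lp.inner_eq_tsum, ← (hasSum_extend_mul.1 h).tsum_eq]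
  exact tsum_congr fun t => mul_comm _ _

/-- The coboundary operator from `1`-forms to `2`-forms. -/
def coboundary (hX : X ≤ T22) : X.L2Form →L[ℝ] TwoForm X :=
  coboundaryₗ.mkContinuous ‖boundary hX‖ fun f => by
    have h := inner_boundary_coboundaryₗ hX (coboundaryₗ f) f
    rw [real_inner_self_eq_norm_sq] at h
    have h1 : ‖coboundaryₗ f‖ ^ 2 ≤ ‖boundary hX‖ * ‖coboundaryₗ f‖ * ‖f‖ := by
      rw [← h]
      exact (real_inner_le_norm _ _).trans
        (mul_le_mul_of_nonneg_right ((boundary hX).le_opNorm _) (norm_nonneg _))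
    rcases (norm_nonneg (coboundaryₗ f)).eq_or_lt with h0 | h0
    · rw [← h0]
      positivity
    · nlinarith

theorem coboundary_apply (hX : X ≤ T22) (f : X.L2Form)
    (t : {t : Option Edge // tri t ∈ X.faces}) :
    coboundary hX f t = cobdry (scaled f) t := rfl

theorem inner_boundary (hX : X ≤ T22) (F : TwoForm X) (f : X.L2Form) :
    inner ℝ (boundary hX F) f = inner ℝ F (coboundary hX f) :=
  inner_boundary_coboundaryₗ hX F f

theorem extend_coboundary (hX : X ≤ T22) (f : X.L2Form) {t : Option Edge}
    (h : tri t ∈ X.faces) : extend (coboundary hX f) t = cobdry (scaled f) t := dif_pos h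

/-! ### The upper Laplacian is the composition of the two operators -/

/-- The vertex opposite to an edge in the triangle that the edge appeared with. -/
theorem exists_opposite : ∀ e : Edge, ∃ u, ({u, src e, tgt e} : Finset T22Vertex) = tri (parent e) ∧
    ∀ Φ : T22Vertex → T22Vertex → ℝ, (∀ v w, Φ w v = - Φ v w) →
      Φ (src e) (tgt e) - Φ u (tgt e) + Φ u (src e) =
        cobdry (fun e => Φ (src e) (tgt e)) (parent e)
  | (i, []) => by
    refine ⟨Sum.inl (i + 2), ?_, fun Φ hΦ => ?_⟩
    · fin_cases i <;> decide
    · have h : ∀ j : Fin 3, cobdry (fun e => Φ (src e) (tgt e)) none = Φ (Sum.inl j) (Sum.inl (j + 1))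
          + Φ (Sum.inl (j + 1)) (Sum.inl (j + 2)) + Φ (Sum.inl (j + 2)) (Sum.inl j) := by
        have h1 : (0 : Fin 3) + 1 = 1 ∧ (1 : Fin 3) + 1 = 2 ∧ (2 : Fin 3) + 1 = 0 ∧
          (0 : Fin 3) + 2 = 2 ∧ (1 : Fin 3) + 2 = 0 ∧ (2 : Fin 3) + 2 = 1 := by decide
        obtain ⟨h1, h2, h3, h4, h5, h6⟩ := h1
        rw [Fin.forall_fin_succ, Fin.forall_fin_two]
        refine ⟨?_, ?_, ?_⟩
        · simp only [cobdry, src_nil, tgt_nil, h1, h2, h3, h4]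
        · simp only [cobdry, src_nil, tgt_nil, Fin.succ_zero_eq_one, h1, h2, h3, h5]
          ring
        · simp only [cobdry, src_nil, tgt_nil, Fin.succ_one_eq_two, h1, h2, h3, h6]
          ring
      rw [parent_nil, h i, src_nil, tgt_nil, hΦ (Sum.inl (i + 1)) (Sum.inl (i + 2))]
      ring
  | (i, false :: w) => by
    refine ⟨tgt (i, w), ?_, fun Φ hΦ => ?_⟩
    · simp only [src_false, tgt_false, parent_cons, tri]
      rw [Finset.insert_comm]
    · simp only [src_false, tgt_false, parent_cons, cobdry, child, src_true, tgt_true]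
      rw [hΦ (src (i, w)) (tgt (i, w)), hΦ (Sum.inr (i, w)) (tgt (i, w))]
      ring
  | (i, true :: w) => by
    refine ⟨src (i, w), ?_, fun Φ hΦ => ?_⟩
    · simp only [src_true, tgt_true, parent_cons, tri]
      rw [Finset.pair_comm]
    · simp only [src_false, tgt_false, parent_cons, cobdry, child, src_true, tgt_true]
      ring

theorem coboundaryOne_of_mem (f : T22Vertex → T22Vertex → ℝ) {u v w : T22Vertex}
    (h : {u, v, w} ∈ X.cells 2) : X.coboundaryOne f u v w =
      X.weight {v, w} * f v w - X.weight {u, w} * f u w + X.weight {u, v} * f u v := if_pos h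

theorem coboundaryOne_of_notMem (f : T22Vertex → T22Vertex → ℝ) {u v w : T22Vertex}
    (h : {u, v, w} ∉ X.cells 2) : X.coboundaryOne f u v w = 0 := if_neg h

theorem isForm_upperLaplacian (hX : X ≤ T22) (f : X.L2Form) : IsForm (X.upperLaplacian f) := by
  refine ⟨fun v w => ?_, fun v w h => ?_⟩
  · simp only [upperLaplacian, boundaryTwo]
    have h1 : ∀ u, ({u, w, v} : Finset T22Vertex) = {u, v, w} := fun u => by
      rw [Finset.pair_comm]
    rw [← finsum_neg_distrib]
    refine finsum_congr fun u => ?_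
    rw [← finsum_neg_distrib]
    simp only [Set.mem_ofPred_eq, h1]
    refine finsum_congr fun hu => ?_
    rw [coboundaryOne_of_mem _ hu, coboundaryOne_of_mem _ (by rw [h1]; exact hu), f.2.1 v w,
      Finset.pair_comm w v]
    ring
  · simp only [upperLaplacian, boundaryTwo]
    rw [show {u : T22Vertex | {u, v, w} ∈ X.cells 2} = ∅ from ?_, finsum_mem_empty]
    refine Set.eq_empty_of_forall_notMem fun u hu => ?_
    obtain ⟨t, ht⟩ := exists_tri_of_mem_faces (hX hu.1) hu.2
    have hcard : ({v, w} : Finset T22Vertex).card = 2 := by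
      refine le_antisymm Finset.card_le_two ?_
      have h1 := Finset.card_insert_le u {v, w}
      rw [hu.2] at h1
      omega
    obtain ⟨e, he, -⟩ := exists_edge_of_subset_tri hcard (t := t)
      (ht ▸ Finset.subset_insert u {v, w})
    exact h e he.symm

theorem eq_of_insert_eq {u u' a b : T22Vertex} (h : ({u, a, b} : Finset T22Vertex) = {u', a, b})
    (hc : ({u, a, b} : Finset T22Vertex).card = 3) : u = u' := by
  have h1 : u ∈ ({u', a, b} : Finset T22Vertex) := by rw [← h]; simp
  rcases Finset.mem_insert.1 h1 with h1 | h1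
  · exact h1
  · rw [Finset.insert_eq_of_mem h1] at hc
    have := Finset.card_le_two (a := a) (b := b)
    omega

theorem upperLaplacian_eq (hX : X ≤ T22) (f : X.L2Form) (v w : T22Vertex) :
    X.upperLaplacian f v w = boundary hX (coboundary hX f) v w := by
  refine (isForm_upperLaplacian hX f).ext (isForm_l2Form hX _) (fun e => ?_) v w
  rw [boundary_apply, bdry]
  have hΦ : ∀ v w, X.weight {w, v} * f w v = - (X.weight {v, w} * f v w) := fun v w => by
    rw [f.2.1 v w, Finset.pair_comm]; ring
  obtain ⟨u, hu, hcob⟩ := exists_opposite e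
  have hu' : ({Sum.inr e, src e, tgt e} : Finset T22Vertex) = tri (some e) := by
    rw [tri, Finset.insert_comm, Finset.pair_comm]
  have hne : u ≠ Sum.inr e := by
    rintro rfl
    exact parent_ne_some e (tri_injective (hu.symm.trans hu'))
  rw [upperLaplacian, boundaryTwo]
  have hsub : ∀ u' : T22Vertex, {u', src e, tgt e} ∈ X.cells 2 → u' = u ∨ u' = Sum.inr e := by
    intro u' h
    obtain ⟨t, ht⟩ := exists_tri_of_mem_faces (hX h.1) h.2
    have : Incident e t := edge_subset_tri_iff.1 (ht ▸ Finset.subset_insert _ _)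
    rcases this with rfl | rfl
    · exact Or.inl (eq_of_insert_eq (ht.trans hu.symm) h.2)
    · exact Or.inr (eq_of_insert_eq (ht.trans hu'.symm) h.2)
  rw [finsum_mem_inter_support_eq _ _ ({u, Sum.inr e} : Set T22Vertex), finsum_mem_pair hne]
  · rw [sub_eq_add_neg]
    congr 1
    · by_cases h : tri (parent e) ∈ X.faces
      · rw [extend_coboundary hX f h, coboundaryOne_of_mem]
        · exact hcob (fun v w => X.weight {v, w} * f v w) hΦ
        · rw [hu]
          exact tri_mem_cells_iff.2 h
      · rw [extend_of_notMem _ h, coboundaryOne_of_notMem]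
        rw [hu]
        exact fun h' => h h'.1
    · by_cases h : tri (some e) ∈ X.faces
      · rw [extend_coboundary hX f h, coboundaryOne_of_mem]
        · simp only [cobdry, scaled, child]
          rw [hΦ (src e) (Sum.inr e)]
          change _ = -(X.weight {src e, Sum.inr e} * f (src e) (Sum.inr e) +
            X.weight {Sum.inr e, tgt e} * f (Sum.inr e) (tgt e) -
            X.weight {src e, tgt e} * f (src e) (tgt e))
          ring
        · rw [hu']
          exact tri_mem_cells_iff.2 h
      · rw [extend_of_notMem _ h, coboundaryOne_of_notMem, neg_zero]
        rw [hu']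
        exact fun h' => h h'.1
  · ext u'
    simp only [Set.mem_inter_iff, Set.mem_ofPred_eq, Function.mem_support, Set.mem_insert_iff,
      Set.mem_singleton_iff]
    refine and_congr_left fun h => ⟨hsub u', fun _ => ?_⟩
    by_contra hcon
    exact h (coboundaryOne_of_notMem _ hcon)

/-! ### The Laplacian on the space of cycles -/

theorem scaled_eq_sub {f : X.L2Form} {g : T22Vertex → ℝ}
    (hg : ∀ v w, f v w = X.coboundaryZero g v w) {e : Edge} (he : edge e ∈ X.faces) :
    scaled f e = g (tgt e) - g (src e) := by
  rw [scaled, hg, coboundaryZero]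
  have h1 : ({src e, tgt e} : Finset T22Vertex) ∈ X.cells 1 := edge_mem_cells_iff.2 he
  rw [if_pos h1]
  exact mul_inv_cancel_left₀ (X.weight_pos _).ne' _

theorem coboundary_eq_zero (hX : X ≤ T22) {f : X.L2Form} (hf : f ∈ X.coboundaries) :
    coboundary hX f = 0 := by
  obtain ⟨g, -, -, hg⟩ := hf
  have h : ∀ e, edge e ∈ X.faces → scaled f e = g (tgt e) - g (src e) := fun e he =>
    scaled_eq_sub hg he
  refine lp.ext (funext fun t => ?_)
  rw [coboundary_apply]
  obtain ⟨_ | e, ht⟩ := t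
  · simp only [cobdry]
    rw [h (0, []) (edge_mem_of_incident (Or.inl rfl) ht),
      h (1, []) (edge_mem_of_incident (Or.inl rfl) ht),
      h (2, []) (edge_mem_of_incident (Or.inl rfl) ht)]
    change g (Sum.inl 1) - g (Sum.inl 0) + (g (Sum.inl 2) - g (Sum.inl 1)) +
      (g (Sum.inl 0) - g (Sum.inl 2)) = 0
    ring
  · simp only [cobdry]
    rw [h (child false e) (edge_mem_of_incident (Or.inl rfl) ht),
      h (child true e) (edge_mem_of_incident (Or.inl rfl) ht),
      h e (edge_mem_of_incident (Or.inr rfl) ht)]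
    change g (Sum.inr e) - g (src e) + (g (tgt e) - g (Sum.inr e)) - (g (tgt e) - g (src e)) = 0
    ring

theorem boundary_mem_cycles (hX : X ≤ T22) (F : TwoForm X) : boundary hX F ∈ X.cycles := by
  refine (Submodule.mem_orthogonal _ _).2 fun f hf => ?_
  rw [real_inner_comm, inner_boundary, coboundary_eq_zero hX hf, inner_zero_right]

/-- The coboundary operator on the space of cycles. -/
def cyclesCoboundary (hX : X ≤ T22) : X.cycles →L[ℝ] TwoForm X :=
  (coboundary hX).comp X.cycles.subtypeL

/-- The boundary operator with values in the space of cycles. -/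
def cyclesBoundary (hX : X ≤ T22) : TwoForm X →L[ℝ] X.cycles :=
  (boundary hX).codRestrict X.cycles (boundary_mem_cycles hX)

theorem inner_cyclesBoundary (hX : X ≤ T22) (F : TwoForm X) (f : X.cycles) :
    inner ℝ (cyclesBoundary hX F) f = inner ℝ F (cyclesCoboundary hX f) :=
  inner_boundary hX F f

theorem gapSpectrum_eq (hX : X ≤ T22) :
    X.gapSpectrum = spectrum ℝ ((cyclesBoundary hX).comp (cyclesCoboundary hX)) := by
  have h : ∀ (f : X.cycles) (v w : T22Vertex),
      ((cyclesBoundary hX).comp (cyclesCoboundary hX) f).1 v w = X.upperLaplacian f.1 v w :=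
    fun f v w => (upperLaplacian_eq hX f.1 v w).symm
  ext μ
  constructor
  · rintro ⟨T, hT, hμ⟩
    convert hμ
    ext1 f
    exact Subtype.ext (Subtype.ext (funext fun v => funext fun w => by
      rw [h, hT]))
  · exact fun hμ => ⟨_, h, hμ⟩

end T22

/-! ### The spectrum of `B A` for adjoint operators `A` and `B` -/

section Spectrum

variable {Z H : Type*} [NormedAddCommGroup Z] [InnerProductSpace ℝ Z] [NormedAddCommGroup H]
  [InnerProductSpace ℝ H] {A : Z →L[ℝ] H} {B : H →L[ℝ] Z}

theorem mem_spectrum_of_eigenvector {T : Z →L[ℝ] Z} {μ : ℝ} {z : Z} (hz : z ≠ 0)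
    (h : T z = μ • z) : μ ∈ spectrum ℝ T := by
  rw [spectrum.mem_iff]
  intro hu
  obtain ⟨u, hu⟩ := hu
  refine hz ?_
  have h1 : (u.inv * u.val) z = z := by rw [u.inv_val]; rfl
  rw [← h1, hu, mul_apply_eq_comp]
  simp [h, Algebra.algebraMap_eq_smul_one]

/-- The non-zero spectra of `B A` and `A B` agree, and `A B` is positive. Only `H` has to be
complete. -/
theorem nonneg_of_mem_spectrum_comp [CompleteSpace H]
    (hadj : ∀ x z, inner ℝ (B x) z = inner ℝ x (A z)) {μ : ℝ}
    (hμ : μ ∈ spectrum ℝ (B.comp A)) : 0 ≤ μ := by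
  by_contra! hneg
  refine hμ ?_
  have hunit : IsUnit (A.comp B - μ • (1 : H →L[ℝ] H)) := by
    refine ContinuousLinearMap.isUnit_of_forall_le_norm_inner_map _
      (c := ⟨-μ, (neg_pos.2 hneg).le⟩) (neg_pos.2 hneg) fun x => ?_
    change ‖x‖ ^ 2 * -μ ≤ _
    have h1 : inner ℝ ((A.comp B - μ • (1 : H →L[ℝ] H)) x) x = ‖B x‖ ^ 2 - μ * ‖x‖ ^ 2 := by
      change inner ℝ (A (B x) - μ • x) x = _
      rw [inner_sub_left, real_inner_smul_left, real_inner_comm, ← hadj,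
        real_inner_self_eq_norm_sq, real_inner_self_eq_norm_sq]
    rw [h1]
    refine le_trans ?_ (Real.le_norm_self _)
    nlinarith [sq_nonneg ‖B x‖]
  obtain ⟨u, hu⟩ := hunit
  set R : H →L[ℝ] H := u.inv
  have h1 : ∀ y, A (B (R y)) = y + μ • R y := fun y => by
    have h : (u.val * u.inv) y = y := by rw [u.val_inv]; rfl
    rw [hu] at h
    exact sub_eq_iff_eq_add.1 h
  have h2 : ∀ y, R (A (B y)) = y + μ • R y := fun y => by
    have h : (u.inv * u.val) y = y := by rw [u.inv_val]; rfl
    rw [hu] at h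
    have h' : R (A (B y) - μ • y) = y := h
    rw [map_sub, map_smul] at h'
    exact sub_eq_iff_eq_add.1 h'
  refine ⟨⟨algebraMap ℝ (Z →L[ℝ] Z) μ - B.comp A,
    μ⁻¹ • (1 - B.comp (R.comp A)), ?_, ?_⟩, rfl⟩
  · ext z
    simp only [mul_apply_eq_comp, Algebra.algebraMap_eq_smul_one,
      sub_apply, smul_apply,
      one_apply_eq_self, ContinuousLinearMap.comp_apply, map_smul, map_sub, h1,
      map_add, smul_sub, smul_add, smul_smul, inv_mul_cancel₀ hneg.ne, one_smul]
    abel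
  · ext z
    simp only [mul_apply_eq_comp, Algebra.algebraMap_eq_smul_one,
      sub_apply, smul_apply,
      one_apply_eq_self, ContinuousLinearMap.comp_apply, map_smul, map_sub, h2,
      map_add, smul_sub, smul_add, smul_smul, mul_inv_cancel₀ hneg.ne, inv_mul_cancel₀ hneg.ne,
      one_smul]
    abel

/-- If `A` and `B` are injective and `H` is finite-dimensional, the least spectral value of `B A`
is the least eigenvalue of `A B`, that is, the minimum of the quotients `‖B x‖ ^ 2 / ‖x‖ ^ 2`. -/
theorem exists_isLeast_spectrum_comp [FiniteDimensional ℝ H] [Nontrivial H]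
    (hadj : ∀ x z, inner ℝ (B x) z = inner ℝ x (A z)) (hA : Function.Injective A)
    (hB : Function.Injective B) :
    ∃ μ, IsLeast (spectrum ℝ (B.comp A)) μ ∧ (∀ x, μ * ‖x‖ ^ 2 ≤ ‖B x‖ ^ 2) ∧
      ∃ x ≠ 0, ‖B x‖ ^ 2 = μ * ‖x‖ ^ 2 := by
  have hquad : ∀ x, inner ℝ (A (B x)) x = ‖B x‖ ^ 2 := fun x => by
    rw [real_inner_comm, ← hadj, real_inner_self_eq_norm_sq]
  have hsymm : ((A.comp B : H →L[ℝ] H) : H →ₗ[ℝ] H).IsSymmetric := fun x y => by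
    change inner ℝ (A (B x)) y = inner ℝ x (A (B y))
    rw [real_inner_comm, ← hadj, ← hadj, real_inner_comm]
  obtain ⟨x, hx⟩ := hsymm.hasEigenvalue_iInf_of_finiteDimensional.exists_hasEigenvector
  set μ : ℝ := ⨅ x : {x : H // x ≠ 0},
    RCLike.re (inner ℝ (((A.comp B : H →L[ℝ] H) : H →ₗ[ℝ] H) x) (x : H)) / ‖(x : H)‖ ^ 2
  have hx1 : A (B x) = μ • x := hx.apply_eq_smul
  have hx0 : x ≠ 0 := hx.2
  have hle : ∀ y, μ * ‖y‖ ^ 2 ≤ ‖B y‖ ^ 2 := by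
    intro y
    by_cases hy : y = 0
    · simp [hy]
    have h1 : μ ≤ inner ℝ (A (B y)) y / ‖y‖ ^ 2 := by
      refine ciInf_le ⟨0, ?_⟩ (⟨y, hy⟩ : {x : H // x ≠ 0})
      rintro _ ⟨⟨z, hz⟩, rfl⟩
      change 0 ≤ inner ℝ (A (B z)) z / ‖z‖ ^ 2
      rw [hquad]
      positivity
    rwa [hquad, le_div_iff₀ (by positivity)] at h1
  refine ⟨μ, ⟨mem_spectrum_of_eigenvector (z := B x) ?_ ?_, fun ν hν => ?_⟩, hle, x, hx0, ?_⟩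
  · exact fun h => hx0 (hB (by rw [h, map_zero]))
  · rw [ContinuousLinearMap.comp_apply, hx1, map_smul]
  · have : FiniteDimensional ℝ Z := FiniteDimensional.of_injective (A : Z →ₗ[ℝ] H) hA
    have : CompleteSpace Z := FiniteDimensional.complete ℝ Z
    rw [spectrum.mem_iff, ContinuousLinearMap.isUnit_iff_bijective] at hν
    have hninj : ¬ Function.Injective (algebraMap ℝ (Z →L[ℝ] Z) ν - B.comp A) := fun hinj =>
      hν ⟨hinj, LinearMap.surjective_of_injective (f :=
        ((algebraMap ℝ (Z →L[ℝ] Z) ν - B.comp A : Z →L[ℝ] Z) : Z →ₗ[ℝ] Z)) hinj⟩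
    rw [injective_iff_map_eq_zero] at hninj
    push Not at hninj
    obtain ⟨z, hz, hz0⟩ := hninj
    have hz1 : B (A z) = ν • z := by
      have h : ν • z - B (A z) = 0 := by
        simpa [Algebra.algebraMap_eq_smul_one] using hz
      exact (sub_eq_zero.1 h).symm
    have h1 : ‖B (A z)‖ ^ 2 = ν * ‖A z‖ ^ 2 := by
      rw [← hquad, hz1, map_smul, real_inner_smul_left, real_inner_self_eq_norm_sq]
    have h2 := hle (A z)
    rw [h1] at h2
    have h3 : A z ≠ 0 := fun h => hz0 (hA (by rw [h, map_zero]))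
    exact le_of_mul_le_mul_right h2 (by positivity)
  · rw [← hquad, hx1, real_inner_smul_left, real_inner_self_eq_norm_sq]

end Spectrum

namespace T22

open PreAbstractSimplicialComplex

/-! ### The spectral gap of `T22` -/

/-- There are `2 ^ k` words of length `k`. -/
theorem hasSum_length {h : ℕ → ℝ} (h0 : ∀ k, 0 ≤ h k) {s : ℝ}
    (hs : HasSum (fun k => 2 ^ k * h k) s) : HasSum (fun v : List Bool => h v.length) s := by
  refine (List.equivSigmaTuple (α := Bool)).symm.hasSum_iff.1 ?_
  have hf : ∀ k, HasSum (fun v : Fin k → Bool => h (List.ofFn v).length) (2 ^ k * h k) := by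
    intro k
    convert hasSum_fintype (fun v : Fin k → Bool => h (List.ofFn v).length) using 1
    simp
  refine HasSum.sigma_of_hasSum hs hf ((summable_sigma_of_nonneg fun _ => h0 _).2
    ⟨fun k => (hf k).summable, hs.summable.congr fun k => (hf k).tsum_eq.symm⟩)

/-- Every vertex of `T22` is contained in infinitely many edges, so that a square-summable
function with square-summable coboundary vanishes. -/
theorem coboundaries_eq_bot : T22.coboundaries = ⊥ := by
  rw [Submodule.eq_bot_iff]
  rintro f ⟨g, -, hg, hf⟩
  have hscaled : ∀ e, scaled f e = g (tgt e) - g (src e) := fun e =>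
    scaled_eq_sub hf (edge_mem_faces e)
  have key : ∀ e, g (src e) = 0 := by
    intro e
    set E : ℕ → Edge := fun n => (child false)^[n] e
    have hstep : ∀ n, E (n + 1) = child false (E n) := fun n =>
      Function.iterate_succ_apply' _ _ _
    have hlen : ∀ n, (E n).2.length = e.2.length + n := fun n => by
      induction n with
      | zero => rfl
      | succ n ih =>
        rw [hstep]
        simp only [child, List.length_cons]
        omega
    have hinj : Function.Injective E := fun m n h => by
      have := congrArg (fun e : Edge => e.2.length) h
      simp only [hlen] at this
      omega
    have hsrc : ∀ n, src (E n) = src e := fun n => by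
      induction n with
      | zero => rfl
      | succ n ih =>
        rw [hstep]
        exact ih
    have h1 : Summable fun n => g (Sum.inr (E n)) ^ 2 :=
      hg.comp_injective (Sum.inr_injective.comp hinj)
    have h2 : Summable fun n => scaled f (child false (E n)) ^ 2 :=
      (summable_scaled_sq f).comp_injective ((child_injective false).comp hinj)
    have h3 := ((h1.mul_left 2).add (h2.mul_left 2)).tendsto_atTop_zero
    have h4 : g (src e) ^ 2 ≤ 0 := by
      refine ge_of_tendsto' h3 fun n => ?_
      have h5 : scaled f (child false (E n)) = g (Sum.inr (E n)) - g (src e) := by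
        rw [hscaled, ← hsrc n]
        rfl
      rw [h5]
      nlinarith [sq_nonneg (2 * g (Sum.inr (E n)) - g (src e))]
    nlinarith
  have hzero : ∀ v, g v = 0
    | Sum.inl i => key (i, [])
    | Sum.inr e => key (child true e)
  refine l2Form_ext le_rfl fun e => ?_
  rw [hf, coboundaryZero]
  change _ = (0 : ℝ)
  simp [hzero]

/-- The values at the first triangle, which add up to zero, of `closedForm`. -/
def rootValue : Fin 3 → ℝ := ![1, -1, 0]

/-- A closed square-summable form: its value on an edge is twice that on the two edges that appear
with the triangle attached to that edge. -/
def closedForm : T22.L2Form :=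
  ofEdges (fun e => rootValue e.1 * (1 / 2) ^ e.2.length)
    (fun e h => (h (edge_mem_faces e)).elim) (by
      have h1 : HasSum (fun k : ℕ => (2 : ℝ) ^ k * (1 / 4) ^ k) (1 - 1 / 2)⁻¹ :=
        (hasSum_geometric_of_lt_one (by norm_num) (by norm_num)).congr_fun fun k => by
          rw [← mul_pow]; norm_num
      have h2 := (hasSum_length (fun k => by positivity) h1).summable
      have h3 := (hasSum_fintype fun i => rootValue i ^ 2).summable.mul_of_nonneg h2
        (fun i => sq_nonneg _) (fun w => by positivity)
      refine h3.congr fun e => ?_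
      rw [mul_pow, ← pow_mul, mul_comm e.2.length 2, pow_mul]
      norm_num)

theorem closedForm_apply (e : Edge) :
    closedForm (src e) (tgt e) = rootValue e.1 * (1 / 2) ^ e.2.length := ofEdges_apply _ _ e

theorem coboundary_closedForm : coboundary le_rfl closedForm = 0 := by
  have h : ∀ e, scaled closedForm e = 1 / 2 * (rootValue e.1 * (1 / 2) ^ e.2.length) := fun e => by
    rw [scaled, weight_eq_half le_rfl (tri_mem_faces _) (tri_mem_faces _), closedForm_apply]
  refine lp.ext (funext fun t => ?_)
  rw [coboundary_apply]
  obtain ⟨_ | e, ht⟩ := t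
  · simp [cobdry, h, rootValue]
  · simp only [cobdry, h, child, List.length_cons, pow_succ]
    change _ = (0 : ℝ)
    ring

theorem isLeast_gapSpectrum : IsLeast T22.gapSpectrum 0 := by
  rw [gapSpectrum_eq le_rfl]
  refine ⟨?_, fun μ hμ => nonneg_of_mem_spectrum_comp (inner_cyclesBoundary le_rfl) hμ⟩
  have hmem : closedForm ∈ T22.cycles := by
    rw [cycles, coboundaries_eq_bot, Submodule.bot_orthogonal_eq_top]
    trivial
  refine mem_spectrum_of_eigenvector (z := ⟨closedForm, hmem⟩) (fun h => ?_) ?_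
  · have h1 : closedForm = 0 := congrArg Subtype.val h
    have h2 := closedForm_apply (0, [])
    rw [h1] at h2
    change (0 : ℝ) = _ at h2
    simp [rootValue] at h2
  · have h : cyclesCoboundary le_rfl ⟨closedForm, hmem⟩ = 0 := coboundary_closedForm
    rw [ContinuousLinearMap.comp_apply, h, map_zero, zero_smul]

end T22

/-! ### Balls in a complex -/

theorem SimpleGraph.exists_adj_of_edist_le_succ {V : Type*} {G : SimpleGraph V} {u v : V} {k : ℕ}
    (h : G.edist u v ≤ (k + 1 : ℕ)) : u = v ∨ ∃ w, G.edist u w ≤ k ∧ G.Adj w v := by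
  have htop : G.edist v u ≠ ⊤ := by
    rw [SimpleGraph.edist_comm]
    exact ne_top_of_le_ne_top (ENat.natCast_ne_top _) h
  obtain ⟨p, hp⟩ := SimpleGraph.exists_walk_of_edist_ne_top htop
  rw [SimpleGraph.edist_comm, ← hp, Nat.cast_le] at h
  cases p with
  | nil => exact Or.inl rfl
  | cons hadj q =>
    refine Or.inr ⟨_, ?_, hadj.symm⟩
    rw [SimpleGraph.edist_comm]
    refine (SimpleGraph.edist_le q).trans ?_
    rw [SimpleGraph.Walk.length_cons] at h
    exact_mod_cast Nat.succ_le_succ_iff.1 h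

theorem SimpleGraph.edist_le_succ_of_adj {V : Type*} {G : SimpleGraph V} {u v w : V} {k : ℕ}
    (h : G.edist u v ≤ k) (hadj : G.Adj v w) : G.edist u w ≤ (k + 1 : ℕ) := by
  refine (SimpleGraph.edist_triangle (v := v)).trans ?_
  rw [SimpleGraph.edist_eq_one_iff_adj.2 hadj]
  push_cast
  gcongr

namespace PreAbstractSimplicialComplex

theorem cells_mono {V : Type*} {X Y : PreAbstractSimplicialComplex V} (h : X ≤ Y) (j : ℕ) : X.cells j ⊆ Y.cells j := fun _ hs => ⟨h hs.1, hs.2⟩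

variable {V : Type*} [DecidableEq V] {X Y : PreAbstractSimplicialComplex V}

theorem edgeGraph_mono (h : X ≤ Y) : X.edgeGraph ≤ Y.edgeGraph := fun _ _ hadj =>
  ⟨cells_mono h 1 hadj.1, cells_mono h 1 hadj.2.1, cells_mono h 2 hadj.2.2⟩

theorem ball_le (X : PreAbstractSimplicialComplex V) (e : Finset V) (r : ℕ) : X.ball e r ≤ X := by
  rintro s ⟨hs, t, ht, hst, -⟩
  exact (X.isRelLowerSet_faces ht).2 hst hs

theorem mem_ball_of_edist_le {e t : Finset V} {r : ℕ} (ht : t ∈ X.faces) (hc : 2 ≤ t.card)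
    (h : ∀ e' ∈ X.cells 1, e' ⊆ t → X.edgeGraph.edist e e' ≤ r) : t ∈ (X.ball e r).faces :=
  ⟨Finset.card_pos.1 (by omega), t, ht, subset_rfl, hc, h⟩

theorem edist_ball_le {e : Finset V} {r : ℕ} {k : ℕ} (hk : k ≤ r) {e' : Finset V}
    (h : X.edgeGraph.edist e e' ≤ k) : (X.ball e r).edgeGraph.edist e e' ≤ k := by
  induction k generalizing e' with
  | zero =>
    rw [Nat.cast_zero, nonpos_iff_eq_zero, SimpleGraph.edist_eq_zero_iff] at h
    rw [h, SimpleGraph.edist_self]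
    exact zero_le
  | succ k ih =>
    rcases SimpleGraph.exists_adj_of_edist_le_succ h with rfl | ⟨e₂, he₂, hadj⟩
    · rw [SimpleGraph.edist_self]
      exact zero_le
    · refine SimpleGraph.edist_le_succ_of_adj (ih (by omega) he₂) ?_
      -- all edges of the triangle spanned by the last step are adjacent to `e₂`
      have ht : e₂ ∪ e' ∈ (X.ball e r).faces := by
        refine mem_ball_of_edist_le hadj.2.2.1 (by rw [hadj.2.2.2]; norm_num) fun e₃ h₃ hsub => ?_
        have hle : X.edgeGraph.edist e e₃ ≤ (k + 1 : ℕ) := by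
          by_cases hne : e₂ = e₃
          · rw [← hne]
            exact he₂.trans (by exact_mod_cast Nat.le_succ k)
          · refine SimpleGraph.edist_le_succ_of_adj he₂ ⟨hadj.1, h₃, ?_⟩
            rw [Finset.eq_of_subset_of_card_le (t := e₂ ∪ e')
              (Finset.union_subset Finset.subset_union_left hsub)]
            · exact hadj.2.2
            · rw [hadj.2.2.2]
              have h2 : e₂.card = 2 := hadj.1.2
              have h3 : e₃.card = 2 := h₃.2
              have hlt : e₂.card < (e₂ ∪ e₃).card := by
                refine Finset.card_lt_card ⟨Finset.subset_union_left, fun hsub' => hne ?_⟩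
                exact (Finset.eq_of_subset_of_card_le (Finset.subset_union_right.trans hsub')
                  (by omega)).symm
              omega
        exact hle.trans (by exact_mod_cast hk)
      have hdown : ∀ e₃ ∈ X.cells 1, e₃ ⊆ e₂ ∪ e' → e₃ ∈ (X.ball e r).cells 1 :=
        fun e₃ h₃ hsub => ⟨((X.ball e r).isRelLowerSet_faces ht).2 hsub
          (Finset.card_pos.1 (by rw [h₃.2]; norm_num)), h₃.2⟩
      exact ⟨hdown _ hadj.1 Finset.subset_union_left, hdown _ hadj.2.1 Finset.subset_union_right,
        ht, hadj.2.2.2⟩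

theorem ball_ball {e : Finset V} {n r : ℕ} (h : n ≤ r) : (X.ball e r).ball e n = X.ball e n := by
  apply SetLike.coe_injective
  ext s
  refine and_congr_right fun hs => exists_congr fun t => ⟨?_, ?_⟩
  · rintro ⟨ht, hst, hc, hd⟩
    refine ⟨X.ball_le e r ht, hst, hc, fun e' he' hsub => ?_⟩
    refine (SimpleGraph.edist_anti (edgeGraph_mono (X.ball_le e r))).trans (hd e' ⟨?_, he'.2⟩ hsub)
    exact ((X.ball e r).isRelLowerSet_faces ht).2 hsub
      (Finset.card_pos.1 (by rw [he'.2]; norm_num))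
  · rintro ⟨ht, hst, hc, hd⟩
    refine ⟨mem_ball_of_edist_le ht hc fun e' he' hsub => (hd e' he' hsub).trans
      (by exact_mod_cast h), hst, hc, fun e' he' hsub => ?_⟩
    exact edist_ball_le h (hd e' (cells_mono (X.ball_le e r) 1 he') hsub)

/-- The balls around an edge converge to the whole complex. -/
theorem convergesTo_ball {K : ℕ} (hK : ∀ e ∈ X.cells 1, (X.cofaces e).encard ≤ K) {e : Finset V}
    (he : e ∈ X.cells 1) : ConvergesTo (fun r : ℕ => X.ball e r) X := by
  refine ⟨⟨K, fun r s hs => ?_⟩, fun _ => e, e, fun r => ⟨?_, he.2⟩, he, ?_⟩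
  · refine (Set.encard_le_encard fun t ht => ?_).trans (hK s (cells_mono (X.ball_le e r) 1 hs))
    exact ⟨cells_mono (X.ball_le e r) 2 ht.1, ht.2⟩
  · refine mem_ball_of_edist_le he.1 (by rw [he.2]) fun e' he' hsub => ?_
    rw [Finset.eq_of_subset_of_card_le hsub (by rw [he.2, he'.2]), SimpleGraph.edist_self]
    exact zero_le
  · have hpos : ∀ (Y : PreAbstractSimplicialComplex V), ∀ x ∈ {x : ℝ | ∃ n : ℕ,
        MarkedIso (Y.ball e n) e (X.ball e n) e ∧ x = 1 / ((n : ℝ) + 1)}, 0 ≤ x := by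
      rintro Y x ⟨n, -, rfl⟩
      positivity
    refine squeeze_zero (fun r => Real.sInf_nonneg (hpos _)) (fun r => ?_)
      tendsto_one_div_add_atTop_nhds_zero_nat
    refine csInf_le ⟨0, hpos _⟩ ⟨r, ⟨id, Set.injOn_id _, ?_, Finset.image_id⟩, rfl⟩
    rw [ball_ball le_rfl]
    apply SetLike.coe_injective
    change (X.ball e r).faces.image (fun s => s.image id) = (X.ball e r).faces
    simp

end PreAbstractSimplicialComplex

namespace T22

open PreAbstractSimplicialComplex

/-! ### Distances in `T22` -/

theorem length_le_of_edist_le {e₀ e : Edge} {k : ℕ}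
    (h : T22.edgeGraph.edist (edge e₀) (edge e) ≤ k) : e.2.length ≤ e₀.2.length + k := by
  induction k generalizing e with
  | zero =>
    rw [Nat.cast_zero, nonpos_iff_eq_zero, SimpleGraph.edist_eq_zero_iff] at h
    rw [edge_injective h]
    exact le_self_add
  | succ k ih =>
    rcases SimpleGraph.exists_adj_of_edist_le_succ h with h | ⟨s, hs, hadj⟩
    · rw [edge_injective h]
      exact le_self_add
    · obtain ⟨e', rfl⟩ := mem_cells_one_iff.1 hadj.1
      have hlevel : ∀ {e t}, Incident e t → e.2.length ≤ level t ∧ level t ≤ e.2.length + 1 := by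
        rintro e t (rfl | rfl)
        · have : level (some e) = e.2.length + 1 := rfl
          rw [level_some] at this
          omega
        · simp [level]
      obtain ⟨-, t, h1, h2⟩ := edgeGraph_adj_iff.1 hadj
      have := hlevel h1
      have := hlevel h2
      have := ih hs
      omega

theorem edist_append_le (i : Fin 3) (v w : List Bool) :
    T22.edgeGraph.edist (edge (i, w)) (edge (i, v ++ w)) ≤ v.length := by
  induction v with
  | nil => simp
  | cons b v ih => exact SimpleGraph.edist_le_succ_of_adj ih (adj_cons i b (v ++ w))

/-- Contracting the part of `T22` below an edge to the parent of that edge does not increase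
lengths of chains, so that seen from elsewhere the parent is not further away than the edge. -/
theorem edist_parent_le {e₀ a : Edge} {b : Bool}
    (h₀ : ¬ (e₀.1 = a.1 ∧ (child b a).2 <:+ e₀.2)) {k : ℕ} {e : Edge}
    (he : e.1 = a.1 ∧ (child b a).2 <:+ e.2)
    (h : T22.edgeGraph.edist (edge e₀) (edge e) ≤ k) :
    T22.edgeGraph.edist (edge e₀) (edge a) ≤ k := by
  induction k generalizing e with
  | zero =>
    rw [Nat.cast_zero, nonpos_iff_eq_zero, SimpleGraph.edist_eq_zero_iff] at h
    rw [edge_injective h] at h₀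
    exact (h₀ he).elim
  | succ k ih =>
    rcases SimpleGraph.exists_adj_of_edist_le_succ h with h | ⟨s, hs, hadj⟩
    · rw [edge_injective h] at h₀
      exact (h₀ he).elim
    obtain ⟨e', rfl⟩ := mem_cells_one_iff.1 hadj.1
    have hmono : (k : ℕ∞) ≤ (k + 1 : ℕ) := by exact_mod_cast Nat.le_succ k
    by_cases he' : e'.1 = a.1 ∧ (child b a).2 <:+ e'.2
    · exact (ih he' hs).trans hmono
    obtain ⟨hne, t, h1, h2⟩ := edgeGraph_adj_iff.1 hadj
    obtain ⟨i, w⟩ := a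
    obtain ⟨j, u⟩ := e
    obtain ⟨j', u'⟩ := e'
    obtain ⟨rfl, hu⟩ := he
    simp only [child] at *
    rcases h2 with rfl | rfl
    · rcases u with _ | ⟨c, u⟩
      · simp at hu
      rcases List.suffix_cons_iff.1 hu with hu | hu
      · obtain ⟨rfl, rfl⟩ := List.cons_eq_cons.1 hu
        rcases h1 with h1 | h1
        · refine SimpleGraph.edist_le_succ_of_adj hs (edgeGraph_adj_iff.2 ⟨?_, _, Or.inl h1,
            Or.inr rfl⟩)
          rintro h
          rw [h] at h1
          exact parent_ne_some _ h1
        · rw [← Option.some.inj h1]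
          exact hs.trans hmono
      · exfalso
        apply he'
        rcases h1 with h1 | h1
        · rcases u' with _ | ⟨c', u'⟩
          · simp at h1
          · obtain ⟨rfl, rfl⟩ : j' = j ∧ u' = u := by simpa using h1
            exact ⟨rfl, List.suffix_cons_iff.2 (Or.inr hu)⟩
        · obtain ⟨rfl, rfl⟩ : j' = j ∧ u' = u := by simpa using h1
          exact ⟨rfl, hu⟩
    · exfalso
      rcases h1 with h1 | h1
      · rcases u' with _ | ⟨c', u'⟩
        · simp at h1
        · obtain ⟨rfl, rfl⟩ : j' = j ∧ u' = u := by simpa using h1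
          exact he' ⟨rfl, List.suffix_cons_iff.2 (Or.inr hu)⟩
      · exact hne (Option.some.inj h1)

/-! ### Balls in `T22` -/

variable {e₀ : Edge} {r : ℕ}

theorem edge_mem_ball_iff {e : Edge} : edge e ∈ (T22.ball (edge e₀) r).faces ↔
    T22.edgeGraph.edist (edge e₀) (edge e) ≤ r := by
  constructor
  · rintro ⟨-, t, -, hst, -, h⟩
    exact h _ (edge_mem_cells e) hst
  · refine fun h => mem_ball_of_edist_le (edge_mem_faces e) (card_edge e).ge fun e' he' hsub => ?_
    rwa [Finset.eq_of_subset_of_card_le hsub (by rw [card_edge, he'.2])]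

theorem tri_mem_ball_iff {t : Option Edge} : tri t ∈ (T22.ball (edge e₀) r).faces ↔
    ∀ e, Incident e t → edge e ∈ (T22.ball (edge e₀) r).faces := by
  constructor
  · exact fun h e he => edge_mem_of_incident he h
  · refine fun h => mem_ball_of_edist_le (tri_mem_faces t) (by rw [card_tri]; norm_num)
      fun s hs hsub => ?_
    obtain ⟨e, rfl⟩ := mem_cells_one_iff.1 hs
    exact edge_mem_ball_iff.1 (h e (edge_subset_tri_iff.1 hsub))

theorem incident_none_iff {e : Edge} : Incident e none ↔ ∃ i, e = (i, []) := by
  obtain ⟨i, _ | ⟨b, w⟩⟩ := e <;> simp [Incident]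

theorem incident_some_iff {e a : Edge} : Incident e (some a) ↔ e = a ∨ ∃ b, e = child b a := by
  obtain ⟨i, _ | ⟨b, w⟩⟩ := e
  · simp [Incident, child]
  · obtain ⟨j, u⟩ := a
    rw [Incident, or_comm]
    simp [child]

/-- Balls are convex in the tree of triangles: a ball that contains the two edges that appeared with
a triangle contains the triangle. Indeed the centre is not below both of these edges, and
`T22.edist_parent_le` applies to one that it is not below. -/
theorem tri_mem_ball_of_children {a : Edge}
    (h : ∀ b, edge (child b a) ∈ (T22.ball (edge e₀) r).faces) :
    tri (some a) ∈ (T22.ball (edge e₀) r).faces := by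
  refine tri_mem_ball_iff.2 fun e he => ?_
  rcases incident_some_iff.1 he with rfl | ⟨b, rfl⟩
  · rw [edge_mem_ball_iff]
    by_cases h1 : e₀.1 = e.1 ∧ (child false e).2 <:+ e₀.2
    · refine edist_parent_le (b := true) (e := child true e) ?_ ⟨rfl, List.suffix_rfl⟩ (edge_mem_ball_iff.1 (h true))
      rintro ⟨-, h2⟩
      have h3 := (List.suffix_of_suffix_length_le h1.2 h2 le_rfl).eq_of_length rfl
      simp [child] at h3
    · exact edist_parent_le (e := child false e) h1 ⟨rfl, List.suffix_rfl⟩ (edge_mem_ball_iff.1 (h false))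
  · exact h b

theorem finite_edges_ball (e₀ : Edge) (r : ℕ) :
    {e : Edge | edge e ∈ (T22.ball (edge e₀) r).faces}.Finite := by
  refine ((Set.finite_univ (α := Fin 3)).prod
    (List.finite_length_le Bool (e₀.2.length + r))).subset fun e he => ⟨trivial, ?_⟩
  exact length_le_of_edist_le (edge_mem_ball_iff.1 he)

theorem finite_triangles_ball (e₀ : Edge) (r : ℕ) :
    {t : Option Edge | tri t ∈ (T22.ball (edge e₀) r).faces}.Finite := by
  refine (((finite_edges_ball e₀ r).image some).insert none).subset ?_
  rintro (_ | e) h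
  · exact Or.inl rfl
  · have he : edge e ∈ (T22.ball (edge e₀) r).faces :=
      edge_mem_of_incident (t := some e) (Or.inr rfl) h
    exact Or.inr ⟨e, he, rfl⟩

theorem finite_vertices_ball (e₀ : Edge) (r : ℕ) :
    {v : T22Vertex | {v} ∈ (T22.ball (edge e₀) r).faces}.Finite := by
  refine ((finite_edges_ball e₀ r).biUnion fun e _ => (edge e).finite_toSet).subset ?_
  rintro v ⟨-, t, ht, hv, hc, h⟩
  rw [Finset.singleton_subset_iff] at hv
  obtain ⟨w, hw, hne⟩ := Finset.exists_mem_ne (s := t) (by omega) v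
  have hsub : {v, w} ⊆ t := by simp [Finset.insert_subset_iff, hv, hw]
  have hcard : ({v, w} : Finset T22Vertex).card = 2 := Finset.card_pair hne.symm
  have hf : {v, w} ∈ T22.faces := (T22.isRelLowerSet_faces ht).2 hsub (by simp)
  obtain ⟨e, he⟩ := exists_edge_of_mem_faces hf hcard
  refine Set.mem_biUnion (x := e) ?_ ?_
  · exact edge_mem_ball_iff.2 (h _ (edge_mem_cells e) (he ▸ hsub))
  · rw [← he]
    simp

/-! ### Closed forms on balls are coboundaries -/

open Classical in
/-- The values of a potential at the end points of the edge `(i, w)`, found along the construction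
of `T22` from its values `g₀` at the first triangle. At the vertex opposite to `(i, w)` the value is
read off from one of the two new edges at that vertex, the second one if the first one is not
in `X`. -/
def potential (X : PreAbstractSimplicialComplex T22Vertex) (φ : Edge → ℝ) (g₀ : Fin 3 → ℝ)
    (i : Fin 3) : List Bool → ℝ × ℝ
  | [] => (g₀ i, g₀ (i + 1))
  | false :: w => ((potential X φ g₀ i w).1,
      if edge (i, false :: w) ∈ X.faces then (potential X φ g₀ i w).1 + φ (i, false :: w)
      else (potential X φ g₀ i w).2 - φ (i, true :: w))
  | true :: w =>
      (if edge (i, false :: w) ∈ X.faces then (potential X φ g₀ i w).1 + φ (i, false :: w)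
      else (potential X φ g₀ i w).2 - φ (i, true :: w), (potential X φ g₀ i w).2)

theorem exists_potential {X : PreAbstractSimplicialComplex T22Vertex} {φ : Edge → ℝ}
    (hroot : (∀ i, edge (i, []) ∈ X.faces) → tri none ∈ X.faces)
    (hconv : ∀ a, (∀ b, edge (child b a) ∈ X.faces) → tri (some a) ∈ X.faces)
    (hφ : ∀ t, tri t ∈ X.faces → cobdry φ t = 0) :
    ∃ g : T22Vertex → ℝ, ∀ e, edge e ∈ X.faces → φ e = g (tgt e) - g (src e) := by
  obtain ⟨g₀, hg₀⟩ : ∃ g₀ : Fin 3 → ℝ, ∀ i, edge (i, []) ∈ X.faces →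
      φ (i, []) = g₀ (i + 1) - g₀ i := by
    -- if a side of the first triangle is missing, one starts at one of its end points
    have hforall : ∀ P : Fin 3 → Prop, (∀ i, P i) ↔ P 0 ∧ P 1 ∧ P 2 := fun P => by
      rw [Fin.forall_fin_succ, Fin.forall_fin_two]; rfl
    simp only [hforall] at hroot ⊢
    have h1 : (0 : Fin 3) + 1 = 1 ∧ (1 : Fin 3) + 1 = 2 ∧ (2 : Fin 3) + 1 = 0 := by decide
    rw [h1.1, h1.2.1, h1.2.2]
    by_cases h0 : edge (0, []) ∈ X.faces
    · by_cases h1 : edge (1, []) ∈ X.faces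
      · refine ⟨![0, φ (0, []), φ (0, []) + φ (1, [])], by simp, by simp, fun h2 => ?_⟩
        have := hφ none (hroot ⟨h0, h1, h2⟩)
        simp only [cobdry] at this
        simp
        linarith
      · exact ⟨![φ (2, []), φ (2, []) + φ (0, []), 0], by simp, fun h => (h1 h).elim, by simp⟩
    · exact ⟨![φ (1, []) + φ (2, []), 0, φ (1, [])], fun h => (h0 h).elim, by simp, by simp⟩
  set p : Edge → ℝ × ℝ := fun e => potential X φ g₀ e.1 e.2 with hp
  set g : T22Vertex → ℝ := Sum.elim g₀ fun e => (p (child true e)).1 with hg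
  have hends : ∀ i w, g (src (i, w)) = (p (i, w)).1 ∧ g (tgt (i, w)) = (p (i, w)).2 := by
    intro i w
    induction w with
    | nil => exact ⟨rfl, rfl⟩
    | cons b w ih =>
      cases b
      · exact ⟨ih.1, rfl⟩
      · exact ⟨rfl, ih.2⟩
  refine ⟨g, ?_⟩
  rintro ⟨i, w⟩ he
  rw [(hends i w).1, (hends i w).2]
  induction w with
  | nil => exact hg₀ i he
  | cons b w ih =>
    simp only [hp] at ih ⊢
    by_cases hf : edge (i, false :: w) ∈ X.faces
    · cases b
      · simp only [potential, if_pos hf]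
        ring
      · simp only [potential, if_pos hf]
        have ht := hconv (i, w) (by rintro (_ | _) <;> assumption)
        have h1 := ih (edge_mem_of_incident (Or.inr rfl) ht)
        have h2 := hφ _ ht
        simp only [cobdry, child] at h2
        linarith
    · cases b
      · exact (hf he).elim
      · simp only [potential, if_neg hf]
        ring

theorem isForm_coboundaryZero {X : PreAbstractSimplicialComplex T22Vertex} (hX : X ≤ T22)
    (g : T22Vertex → ℝ) : IsForm (X.coboundaryZero g) := by
  refine ⟨fun v w => ?_, fun v w h => if_neg fun h' => ?_⟩
  · unfold coboundaryZero
    rw [Finset.pair_comm w v]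
    split_ifs
    · ring
    · exact neg_zero.symm
  · obtain ⟨e, he⟩ := mem_cells_one_iff.1 (cells_mono hX 1 h')
    exact h e he.symm

/-- The first cohomology of a ball vanishes. -/
theorem mem_coboundaries_of_coboundary_eq_zero {f : (T22.ball (edge e₀) r).L2Form}
    (hf : coboundary (T22.ball_le (edge e₀) r) f = 0) :
    f ∈ (T22.ball (edge e₀) r).coboundaries := by
  have hX := T22.ball_le (edge e₀) r
  obtain ⟨g, hg⟩ := exists_potential (X := T22.ball (edge e₀) r) (φ := scaled f)
    (fun h => tri_mem_ball_iff.2 fun e he => by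
      obtain ⟨i, rfl⟩ := incident_none_iff.1 he
      exact h i)
    (fun a h => tri_mem_ball_of_children h)
    (fun t ht => by
      rw [← coboundary_apply hX f ⟨t, ht⟩, hf]
      rfl)
  classical
  set g' : T22Vertex → ℝ := fun v => if {v} ∈ (T22.ball (edge e₀) r).cells 0 then g v else 0
    with hg'
  have heq : ∀ e, edge e ∈ (T22.ball (edge e₀) r).faces → ∀ v ∈ edge e, g' v = g v := by
    intro e he v hv
    refine if_pos ⟨?_, Finset.card_singleton v⟩
    exact ((T22.ball (edge e₀) r).isRelLowerSet_faces he).2 (Finset.singleton_subset_iff.2 hv)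
      (Finset.singleton_nonempty v)
  refine ⟨g', fun v hv => if_neg hv, ?_, fun v w => ?_⟩
  · refine summable_of_hasFiniteSupport ((finite_vertices_ball e₀ r).subset fun v hv => ?_)
    by_contra h
    refine hv ?_
    simp only [hg']
    rw [if_neg fun h' => h h'.1]
    ring
  · refine (isForm_l2Form hX f).ext (isForm_coboundaryZero hX g') (fun e => ?_) v w
    by_cases he : edge e ∈ (T22.ball (edge e₀) r).faces
    · have h1 : ({src e, tgt e} : Finset T22Vertex) ∈ (T22.ball (edge e₀) r).cells 1 :=
        edge_mem_cells_iff.2 he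
      rw [coboundaryZero, if_pos h1, heq e he _ (by simp [edge]), heq e he _ (by simp [edge]),
        ← hg e he]
      exact (inv_mul_cancel_left₀ (weight_pos _ _).ne' _).symm
    · have h1 : ({src e, tgt e} : Finset T22Vertex) ∉ (T22.ball (edge e₀) r).cells 1 :=
        fun h => he h.1
      rw [coboundaryZero, if_neg h1]
      exact f.2.2.1 _ _ h1

theorem cyclesCoboundary_injective :
    Function.Injective (cyclesCoboundary (T22.ball_le (edge e₀) r)) := by
  rw [injective_iff_map_eq_zero]
  rintro ⟨f, hf⟩ h
  have h1 : f ∈ (T22.ball (edge e₀) r).coboundaries := mem_coboundaries_of_coboundary_eq_zero h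
  exact Subtype.ext (inner_self_eq_zero.1 ((Submodule.mem_orthogonal _ _).1 hf f h1))

/-! ### The spectral gap of a ball -/

theorem le_norm_sq_boundary {X : PreAbstractSimplicialComplex T22Vertex} (hX : X ≤ T22)
    (F : TwoForm X) : (3 / 2 - √2) * ‖F‖ ^ 2 ≤ ‖boundary hX F‖ ^ 2 := by
  have hF := hasSum_extend_sq F
  calc (3 / 2 - √2) * ‖F‖ ^ 2 = 1 / 2 * ((3 - 2 * √2) * ∑' t, extend F t ^ 2) := by
        rw [hF.tsum_eq]; ring
    _ ≤ 1 / 2 * ∑' e, bdry (extend F) e ^ 2 := by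
        gcongr
        exact le_tsum_bdry_sq hF.summable
    _ = ∑' e, 1 / 2 * bdry (extend F) e ^ 2 := tsum_mul_left.symm
    _ ≤ ‖boundary hX F‖ ^ 2 := by
        rw [norm_sq_boundary]
        refine ((summable_bdry_sq hF.summable).mul_left _).tsum_le_tsum (fun e => ?_)
          (summable_weight_mul_bdry_sq F)
        exact mul_le_mul_of_nonneg_right (half_le_weight hX e) (sq_nonneg _)

theorem sqrt_two_lt : √2 < (3 / 2 : ℝ) := by
  rw [Real.sqrt_lt' (by norm_num)]
  norm_num

theorem boundary_injective {X : PreAbstractSimplicialComplex T22Vertex} (hX : X ≤ T22) :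
    Function.Injective (boundary hX) := by
  rw [injective_iff_map_eq_zero]
  intro F hF
  have h := le_norm_sq_boundary hX F
  rw [hF, norm_zero, zero_pow two_ne_zero] at h
  have h1 := sqrt_two_lt
  have h2 : ‖F‖ ^ 2 ≤ 0 := by
    by_contra! hpos
    nlinarith [mul_pos (sub_pos.2 h1) hpos]
  exact norm_eq_zero.1 (pow_eq_zero_iff two_ne_zero |>.1 (le_antisymm h2 (sq_nonneg _)))

/-- The radial profile of the test form: the square root of the reciprocal of the number of
triangles at distance `k` below the base edge, cut off at distance `N`. -/
def profile (N k : ℕ) : ℝ := if k < N then (√2 / 2) ^ k else 0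

/-- The test form: radial on the triangles below the edge `e₀`, zero elsewhere. -/
def testForm (e₀ : Edge) (N : ℕ) : Option Edge → ℝ :=
  Function.extend (fun v : List Bool => some ((e₀.1, v ++ e₀.2) : Edge))
    (fun v => profile N v.length) 0

theorem append_injective (e₀ : Edge) :
    Function.Injective fun v : List Bool => ((e₀.1, v ++ e₀.2) : Edge) := fun v v' h => by
  simpa using h

theorem testForm_some (e₀ : Edge) (N : ℕ) (v : List Bool) :
    testForm e₀ N (some (e₀.1, v ++ e₀.2)) = profile N v.length :=
  ((Option.some_injective _).comp (append_injective e₀)).extend_apply _ _ v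

theorem testForm_of_notMem (e₀ : Edge) (N : ℕ) {t : Option Edge}
    (h : ∀ v : List Bool, some (e₀.1, v ++ e₀.2) ≠ t) : testForm e₀ N t = 0 :=
  Function.extend_apply' _ _ _ fun ⟨v, hv⟩ => h v hv

theorem sq_sqrt_two_div_pow (k : ℕ) : (2 : ℝ) ^ k * ((√2 / 2) ^ k) ^ 2 = 1 := by
  rw [← pow_mul, mul_comm k 2, pow_mul, ← mul_pow, div_pow, Real.sq_sqrt (by norm_num)]
  norm_num

theorem hasSum_testForm_sq (e₀ : Edge) (N : ℕ) :
    HasSum (fun t => testForm e₀ N t ^ 2) N := by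
  have h1 : HasSum (fun k => 2 ^ k * profile N k ^ 2) (∑ k ∈ Finset.range N, (1 : ℝ)) := by
    rw [← Finset.sum_congr rfl fun k hk => ?_]
    · refine hasSum_sum_of_ne_finset_zero fun k hk => ?_
      rw [profile, if_neg (by simpa using hk)]
      ring
    · rw [profile, if_pos (by simpa using hk), sq_sqrt_two_div_pow]
  have h2 := hasSum_length (h := fun k => profile N k ^ 2) (fun k => sq_nonneg _) h1
  rw [Finset.sum_const, Finset.card_range, nsmul_one] at h2
  refine (((Option.some_injective _).comp (append_injective e₀)).hasSum_iff fun t ht => ?_).1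
    (h2.congr_fun fun v => ?_)
  · rw [testForm_of_notMem e₀ N fun v hv => ht ⟨v, hv⟩]
    ring
  · simp only [Function.comp_apply, testForm_some]

theorem bdry_testForm_nil (e₀ : Edge) (N : ℕ) :
    bdry (testForm e₀ N) e₀ = - profile N 0 := by
  have h1 := testForm_some e₀ N []
  rw [List.nil_append] at h1
  have h2 : testForm e₀ N (parent e₀) = 0 := by
    refine testForm_of_notMem e₀ N fun v hv => ?_
    have h3 := level_some e₀
    rw [← hv] at h3
    simp only [level, List.length_append] at h3
    omega
  rw [bdry, h2]
  change 0 - testForm e₀ N (some (e₀.1, e₀.2)) = _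
  rw [h1, zero_sub]
  rfl

theorem bdry_testForm_cons (e₀ : Edge) (N : ℕ) (b : Bool) (v : List Bool) :
    bdry (testForm e₀ N) (e₀.1, b :: v ++ e₀.2) =
      profile N v.length - profile N (v.length + 1) := by
  rw [bdry, testForm_some]
  change testForm e₀ N (some (e₀.1, v ++ e₀.2)) - _ = _
  rw [testForm_some]
  rfl

theorem bdry_testForm_of_notMem (e₀ : Edge) (N : ℕ) {e : Edge}
    (h : e ∉ Set.range fun v : List Bool => ((e₀.1, v ++ e₀.2) : Edge)) :
    bdry (testForm e₀ N) e = 0 := by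
  rw [bdry, testForm_of_notMem, testForm_of_notMem, sub_zero]
  · exact fun v hv => h ⟨v, Option.some.inj hv⟩
  · intro v hv
    obtain ⟨i, _ | ⟨b, w⟩⟩ := e
    · simp at hv
    · rw [parent_cons] at hv
      refine h ⟨b :: v, ?_⟩
      simpa using hv

theorem edge_append_mem_ball {v : List Bool} (h : v.length ≤ r) :
    edge (e₀.1, v ++ e₀.2) ∈ (T22.ball (edge e₀) r).faces :=
  edge_mem_ball_iff.2 ((edist_append_le e₀.1 v e₀.2).trans (by exact_mod_cast h))

theorem tri_append_mem_ball {v : List Bool} (h : v.length < r) :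
    tri (some (e₀.1, v ++ e₀.2)) ∈ (T22.ball (edge e₀) r).faces := by
  refine tri_mem_ball_iff.2 fun e he => ?_
  rcases incident_some_iff.1 he with rfl | ⟨b, rfl⟩
  · exact edge_append_mem_ball h.le
  · exact edge_append_mem_ball (v := b :: v) h

/-- The contribution of an edge at distance `k` below the base edge to the energy of the test
form, or an upper bound for it at the two ends of the support. -/
def energyProfile (N : ℕ) : ℕ → ℝ
  | 0 => 1
  | k + 1 => if k + 1 < N then 1 / 2 * ((√2 / 2) ^ k * (1 - √2 / 2)) ^ 2
      else if k + 1 = N then ((√2 / 2) ^ k) ^ 2 else 0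

theorem energyProfile_nonneg (N : ℕ) : ∀ k, 0 ≤ energyProfile N k
  | 0 => zero_le_one
  | k + 1 => by
    rw [energyProfile]
    split_ifs <;> positivity

theorem hasSum_energyProfile (M : ℕ) :
    HasSum (fun k => 2 ^ k * energyProfile (M + 1) k) (M * (3 / 2 - √2) + 3) := by
  have h : M * (3 / 2 - √2) + 3 =
      ∑ k ∈ Finset.range (M + 2), 2 ^ k * energyProfile (M + 1) k := by
    have hs : √2 ^ 2 = (2 : ℝ) := Real.sq_sqrt (by norm_num)
    rw [Finset.sum_range_succ', Finset.sum_range_succ, Finset.sum_congr rfl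
      (g := fun _ => 3 / 2 - √2) fun k hk => ?_, Finset.sum_const, Finset.card_range, nsmul_eq_mul]
    · simp only [energyProfile, lt_irrefl, if_false, if_true]
      rw [pow_succ (2 : ℝ) M, mul_right_comm, sq_sqrt_two_div_pow]
      ring
    · have hk' : k + 1 < M + 1 := by simpa using hk
      simp only [energyProfile, if_pos hk']
      calc (2 : ℝ) ^ (k + 1) * (1 / 2 * ((√2 / 2) ^ k * (1 - √2 / 2)) ^ 2)
          = (2 ^ k * ((√2 / 2) ^ k) ^ 2) * (1 - √2 / 2) ^ 2 := by ring
        _ = 3 / 2 - √2 := by rw [sq_sqrt_two_div_pow]; linarith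
  rw [h]
  refine hasSum_sum_of_ne_finset_zero fun k hk => ?_
  obtain ⟨j, rfl⟩ : ∃ j, k = j + 1 := ⟨k - 1, by simp at hk; omega⟩
  simp only [Finset.mem_range] at hk
  rw [energyProfile, if_neg (by omega), if_neg (by omega), mul_zero]

theorem weight_mul_bdry_testForm_sq_le (v : List Bool) :
    (T22.ball (edge e₀) r).weight (edge (e₀.1, v ++ e₀.2)) *
      bdry (testForm e₀ r) (e₀.1, v ++ e₀.2) ^ 2 ≤ energyProfile r v.length := by
  rcases v with _ | ⟨b, v⟩
  · rw [List.nil_append, bdry_testForm_nil]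
    refine (mul_le_of_le_one_left (sq_nonneg _) (weight_le_one _)).trans ?_
    simp only [profile, energyProfile, List.length_nil, pow_zero]
    split_ifs <;> norm_num
  · rw [bdry_testForm_cons, List.length_cons, energyProfile]
    split_ifs with h1 h2
    · have hw : (T22.ball (edge e₀) r).weight (edge (e₀.1, b :: v ++ e₀.2)) = 1 / 2 :=
        weight_eq_half (T22.ball_le _ _) (tri_append_mem_ball (v := v) (by omega))
          (tri_append_mem_ball (v := b :: v) h1)
      rw [hw, profile, profile, if_pos (by omega), if_pos h1, pow_succ]
      exact le_of_eq (by ring)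
    · refine (mul_le_of_le_one_left (sq_nonneg _) (weight_le_one _)).trans (le_of_eq ?_)
      rw [profile, profile, if_pos (by omega), if_neg (by omega), sub_zero]
    · rw [profile, profile, if_neg (by omega), if_neg (by omega)]
      simp

theorem exists_testForm {r : ℕ} (hr : 1 ≤ r) : ∃ F : TwoForm (T22.ball (edge e₀) r),
    ‖F‖ ^ 2 = r ∧
      ‖boundary (T22.ball_le (edge e₀) r) F‖ ^ 2 ≤ (r - 1) * (3 / 2 - √2) + 3 := by
  obtain ⟨M, rfl⟩ : ∃ M, r = M + 1 := ⟨r - 1, by omega⟩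
  have : Finite {t : Option Edge // tri t ∈ (T22.ball (edge e₀) (M + 1)).faces} :=
    (finite_triangles_ball e₀ (M + 1)).to_subtype
  set F : TwoForm (T22.ball (edge e₀) (M + 1)) :=
    ⟨fun t => testForm e₀ (M + 1) t, memℓp_gen (Summable.of_finite)⟩ with hFdef
  have hF : extend F = testForm e₀ (M + 1) := funext fun t => by
    by_cases ht : tri t ∈ (T22.ball (edge e₀) (M + 1)).faces
    · exact extend_coe F ⟨t, ht⟩
    · rw [extend_of_notMem F ht]
      by_cases h : ∃ v : List Bool, some (e₀.1, v ++ e₀.2) = t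
      · obtain ⟨v, rfl⟩ := h
        rw [testForm_some, profile, if_neg fun h => ht (tri_append_mem_ball h)]
      · exact (testForm_of_notMem e₀ (M + 1) (by simpa using h)).symm
  refine ⟨F, ?_, ?_⟩
  · have h := hasSum_extend_sq F
    rw [hF] at h
    exact h.unique (hasSum_testForm_sq e₀ (M + 1))
  · rw [norm_sq_boundary, hF]
    have h1 := hasSum_length (energyProfile_nonneg (M + 1)) (hasSum_energyProfile M)
    have h2 := summable_weight_mul_bdry_sq F
    rw [hF] at h2
    have h3 := h2.comp_injective (append_injective e₀)
    have h4 := ((append_injective e₀).hasSum_iff fun e he => by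
      rw [bdry_testForm_of_notMem e₀ _ he, zero_pow two_ne_zero, mul_zero]).1 h3.hasSum
    rw [h4.tsum_eq]
    push_cast
    rw [add_sub_cancel_right, ← h1.tsum_eq]
    exact h3.tsum_le_tsum (fun v => weight_mul_bdry_testForm_sq_le v) h1.summable

theorem spectralGap_ball (e₀ : Edge) {r : ℕ} (hr : 1 ≤ r) :
    IsLeast (T22.ball (edge e₀) r).gapSpectrum (T22.ball (edge e₀) r).spectralGap ∧
      3 / 2 - √2 ≤ (T22.ball (edge e₀) r).spectralGap ∧
      (T22.ball (edge e₀) r).spectralGap ≤ 3 / 2 - √2 + 3 / r := by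
  have hX := T22.ball_le (edge e₀) r
  have hfin : Finite {t : Option Edge // tri t ∈ (T22.ball (edge e₀) r).faces} :=
    (finite_triangles_ball e₀ r).to_subtype
  have : FiniteDimensional ℝ (TwoForm (T22.ball (edge e₀) r)) := by
    have := Fintype.ofFinite {t : Option Edge // tri t ∈ (T22.ball (edge e₀) r).faces}
    exact (lpPiLpₗᵢ (p := 2) (fun _ : {t : Option Edge // tri t ∈ (T22.ball (edge e₀) r).faces} => ℝ)
      ℝ).symm.toLinearEquiv.finiteDimensional
  obtain ⟨F, hF, hbF⟩ := exists_testForm (e₀ := e₀) hr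
  have hr0 : (0 : ℝ) < r := by exact_mod_cast hr
  have : Nontrivial (TwoForm (T22.ball (edge e₀) r)) :=
    ⟨F, 0, fun h => by rw [h, norm_zero, zero_pow two_ne_zero] at hF; exact hr0.ne hF⟩
  obtain ⟨μ, hμ, hle, G, hG0, hG⟩ := exists_isLeast_spectrum_comp (inner_cyclesBoundary hX)
    cyclesCoboundary_injective fun F F' h => boundary_injective hX (congrArg Subtype.val h)
  rw [← gapSpectrum_eq hX] at hμ
  have hgap : (T22.ball (edge e₀) r).spectralGap = μ := hμ.csInf_eq
  rw [hgap]
  refine ⟨hμ, ?_, ?_⟩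
  · have h1 : (3 / 2 - √2) * ‖G‖ ^ 2 ≤ μ * ‖G‖ ^ 2 :=
      (le_norm_sq_boundary hX G).trans (le_of_eq hG)
    exact le_of_mul_le_mul_right h1 (by positivity)
  · have h1 : μ * ‖F‖ ^ 2 ≤ (r - 1) * (3 / 2 - √2) + 3 := (hle F).trans hbF
    rw [hF] at h1
    have h2 : (3 / 2 - √2 + 3 / r) * r = (3 / 2 - √2) * r + 3 := by
      field_simp
    nlinarith [sqrt_two_lt]

theorem tendsto_spectralGap_ball (e₀ : Edge) :
    Tendsto (fun r : ℕ => (T22.ball (edge e₀) r).spectralGap) atTop (𝓝 (3 / 2 - √2)) := by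
  have h : Tendsto (fun r : ℕ => 3 / 2 - √2 + 3 / (r : ℝ)) atTop (𝓝 (3 / 2 - √2)) := by
    simpa using tendsto_const_nhds.add (tendsto_const_div_atTop_nhds_zero_nat (3 : ℝ))
  refine tendsto_of_tendsto_of_tendsto_of_le_of_le' tendsto_const_nhds h ?_ ?_
  · filter_upwards [eventually_ge_atTop 1] with r hr using (spectralGap_ball e₀ hr).2.1
  · filter_upwards [eventually_ge_atTop 1] with r hr using (spectralGap_ball e₀ hr).2.2

end T22

end

theorem theorem3p10 :
    -- `T22` is a `2`-regular arboreal triangle complex,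
    (T22.IsArboreal ∧ T22.IsRegular 2) ∧
    -- with spectral gap zero (and the minimum is attained),
    (IsLeast T22.gapSpectrum T22.spectralGap ∧ T22.spectralGap = 0) ∧
    -- while for the balls around any of its edges
    ∀ e₀ ∈ T22.cells 1,
      -- the spectral gaps are minima and tend to `3/2 - √2`;
      (∀ r : ℕ, 1 ≤ r → IsLeast (T22.ball e₀ r).gapSpectrum (T22.ball e₀ r).spectralGap) ∧
      Tendsto (fun r : ℕ => (T22.ball e₀ r).spectralGap) atTop (𝓝 (3 / 2 - Real.sqrt 2)) ∧
      -- so the balls converge to `T22`, and the Alon-Boppana inequality fails for them.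
      PreAbstractSimplicialComplex.ConvergesTo (fun r : ℕ => T22.ball e₀ r) T22 ∧
      T22.spectralGap < liminf (fun r : ℕ => (T22.ball e₀ r).spectralGap) atTop := by
  have hgap : T22.spectralGap = 0 := T22.isLeast_gapSpectrum.csInf_eq
  refine ⟨⟨T22.isArboreal, T22.isRegular⟩, ⟨hgap ▸ T22.isLeast_gapSpectrum, hgap⟩, fun s hs => ?_⟩
  obtain ⟨e₀, rfl⟩ := T22.mem_cells_one_iff.1 hs
  have hlim := T22.tendsto_spectralGap_ball e₀
  refine ⟨fun r hr => (T22.spectralGap_ball e₀ hr).1, hlim,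
    PreAbstractSimplicialComplex.convergesTo_ball (fun e he => (T22.isRegular e he).le) hs, ?_⟩
  rw [hlim.liminf_eq, hgap]
  exact sub_pos.2 T22.sqrt_two_lt
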